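/- Let $\mathbf X$ be a finitely supported real random variable with $\mathbf E[\mathbf X]=0$ and $\mathrm{Var}[\mathbf X]=1$. There is a constant $C=C_{\mathbf X}>0$, depending only on (the law of) $\mathbf X$, such that the following holds for all integers $n\ge 0$ and $d\ge 2$. Let $$f(x_1,\dots,x_n)=\sum_{S\subseteq[n],\,|S|\le d}\widehat f(S)\prod_{i\in S}x_i$$ be a real multilinear polynomial of degree at most $d$, and for $i\in[n]$ write $\mathrm{Inf}_i[f]=\sum_{S\ni i}\widehat f(S)^2$. Let $J\subseteq[n]$, let $\delta>0$ and $t\ge\sqrt{\delta}$ be real numbers, and suppose that $$\sum_{S:\,S\setminus J\neq\emptyset}\widehat f(S)^2\ \ge\ \delta\qquad\text{and}\qquad \mathrm{Inf}_i[f]\le \delta^2t^{-2}C^{-d}\ \text{ for all } i\notin J.$$ Then, for $\mathbf x=(\mathbf x_1,\dots,\mathbf x_n)$ with independent coordinates distributed as $\mathbf X$, $$\Pr_{\mathbf x\sim\mathbf X^{\otimes n}}\bigl[\,|f(\mathbf x)|\ge t\,\bigr]\ \ge\ \exp\!\left(-\frac{C\,t^2\,d^2\log d}{\delta}\right).$$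 -/

import Mathlib

/-- `μ` is the law of a finitely supported real random variable with mean `0` and variance `1`. -/
structure IsFinitelySupportedStandardized (μ : MeasureTheory.Measure ℝ) : Prop where
  isProbabilityMeasure : MeasureTheory.IsProbabilityMeasure μ
  finite_support : ∃ V : Finset ℝ, μ (V : Set ℝ)ᶜ = 0
  mean_eq_zero : ∫ x, x ∂μ = 0
  variance_eq_one : ProbabilityTheory.variance id μ = 1

/-- A polynomial is multilinear if its degree in each individual variable is at most one. -/
def IsMultilinearPoly {n : ℕ} (f : MvPolynomial (Fin n) ℝ) : Prop :=
  ∀ i : Fin n, f.degreeOf i ≤ 1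

/-- The `S`-th Fourier coefficient of `f`: the coefficient of the monomial `∏ i ∈ S, x i`. -/
noncomputable def multilinearCoeff {n : ℕ} (f : MvPolynomial (Fin n) ℝ) (S : Finset (Fin n)) : ℝ :=
  f.coeff (∑ i ∈ S, Finsupp.single i 1)

/-- The influence of coordinate `i` on a multilinear polynomial `f`: the sum of the squares of
the Fourier coefficients of `f` over all sets containing `i`. -/
noncomputable def influence {n : ℕ} (f : MvPolynomial (Fin n) ℝ) (i : Fin n) : ℝ :=
  ∑ S : Finset (Fin n) with i ∈ S, multilinearCoeff f S ^ 2

/-- The Fourier mass of `f` on the sets that are not contained in `J`. -/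
noncomputable def fourierMassOutside {n : ℕ} (f : MvPolynomial (Fin n) ℝ)
    (J : Finset (Fin n)) : ℝ :=
  ∑ S : Finset (Fin n) with (S \ J).Nonempty, multilinearCoeff f S ^ 2

/-! The idea is to randomise f down to a Rademacher linear form. Let M be the mass outside J. For
each coordinate draw two independent samples y, z of X and a switch, on with probability 1/k if i ∉
J and never on if i ∈ J; the coordinate is a fair choice between y and z if the switch is on, and y
otherwise. The law of x is unchanged (`wMean_pairSelect`). Given the samples and switches, x_i = u_i
+ τ_i v_i with fair signs τ_i, so f is multi-affine in τ with linear coefficients a_i = v_i ∂_i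
f(u).

By pigeonhole over dyadic scales, k can be chosen so that the sets with k ≤ |S \ J| < 2k carry a
1/O(log d) fraction of M (`exists_dyadic_level`); then E ∑ a_i² over i ∉ J is at least M / O(log d)
(`le_wMean_sum_sq`). Small influences and hypercontractivity show that, with probability exp(-O(d)),
the a_i below a small threshold still have square sum A of that order (`wProb_truncated_sum_ge`).

Small coefficients give a Gaussian-type lower tail: |∑ a_i σ_i| ≥ 8dt with probability about
exp(-O(d²t²/A)) (`wProb_rademacher_abs_ge`). To return from the linear part to f, let p(ρ) = f(u +
ρσv). Its derivative at 0 is ∑ a_i σ_i, so a discrete Bernstein inequality gives a node ρ in [-1/2,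
1/2] with |p(ρ)| ≥ t. This p(ρ) is the mean of f(u + τv) over signs τ that are ρ-correlated with σ,
and hypercontractivity makes |f| ≥ t with probability exp(-O(d)) under that law. Since τ is again
uniform after averaging over σ, this bounds the true probability (`wProb_signs_ge`). Bernstein's
inequality accounts for d² in the exponent, the pigeonhole for log d; all exp(-O(d)) factors are
absorbed because M ≤ t². -/

open Finset

/-! ### Expectations on finite spaces and anti-concentration from moments. -/

section FiniteExpectation

variable {Ω : Type*} [Fintype Ω]

/-- The expectation of `F` with respect to the weights `W` on a finite type. -/
noncomputable def wMean (W F : Ω → ℝ) : ℝ := ∑ ω, W ω * F ω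

/-- The weight of the set `s`. -/
noncomputable def wProb (W : Ω → ℝ) (s : Set Ω) : ℝ := wMean W (s.indicator fun _ => 1)

/-- `W` is a probability weight on a finite type. -/
structure IsProbWeight (W : Ω → ℝ) : Prop where
  nonneg : ∀ ω, 0 ≤ W ω
  sum_eq_one : ∑ ω, W ω = 1

theorem wMean_add (W F G : Ω → ℝ) :
    wMean W (fun ω => F ω + G ω) = wMean W F + wMean W G := by
  simp [wMean, mul_add, sum_add_distrib]

theorem wMean_sub (W F G : Ω → ℝ) :
    wMean W (fun ω => F ω - G ω) = wMean W F - wMean W G := by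
  simp [wMean, mul_sub, sum_sub_distrib]

theorem wMean_const_mul (W : Ω → ℝ) (a : ℝ) (F : Ω → ℝ) :
    wMean W (fun ω => a * F ω) = a * wMean W F := by
  simp only [wMean, mul_sum]
  exact sum_congr rfl fun _ _ => by ring

theorem wMean_mul_const (W : Ω → ℝ) (a : ℝ) (F : Ω → ℝ) :
    wMean W (fun ω => F ω * a) = wMean W F * a := by
  simp only [wMean, sum_mul, mul_assoc]

theorem wMean_sum {κ : Type*} (W : Ω → ℝ) (s : Finset κ) (F : κ → Ω → ℝ) :
    wMean W (fun ω => ∑ k ∈ s, F k ω) = ∑ k ∈ s, wMean W (F k) := by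
  simp only [wMean, mul_sum]
  exact sum_comm

theorem IsProbWeight.wMean_const {W : Ω → ℝ} (hW : IsProbWeight W) (a : ℝ) :
    wMean W (fun _ => a) = a := by
  simp [wMean, ← sum_mul, hW.sum_eq_one]

theorem IsProbWeight.wMean_mono {W : Ω → ℝ} (hW : IsProbWeight W) {F G : Ω → ℝ}
    (h : ∀ ω, F ω ≤ G ω) : wMean W F ≤ wMean W G :=
  sum_le_sum fun ω _ => mul_le_mul_of_nonneg_left (h ω) (hW.nonneg ω)

theorem IsProbWeight.wMean_nonneg {W : Ω → ℝ} (hW : IsProbWeight W) {F : Ω → ℝ}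
    (h : ∀ ω, 0 ≤ F ω) : 0 ≤ wMean W F :=
  sum_nonneg fun ω _ => mul_nonneg (hW.nonneg ω) (h ω)

theorem IsProbWeight.wProb_nonneg {W : Ω → ℝ} (hW : IsProbWeight W) (s : Set Ω) :
    0 ≤ wProb W s :=
  hW.wMean_nonneg fun ω => Set.indicator_nonneg (fun _ _ => zero_le_one) ω

theorem IsProbWeight.wProb_mono {W : Ω → ℝ} (hW : IsProbWeight W) {s t : Set Ω} (h : s ⊆ t) :
    wProb W s ≤ wProb W t :=
  hW.wMean_mono fun ω => Set.indicator_le_indicator_of_subset h (fun _ => zero_le_one) ω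

theorem IsProbWeight.mul_wProb_le_wMean {W : Ω → ℝ} (hW : IsProbWeight W) {s : Set Ω} {a : ℝ}
    {F : Ω → ℝ} (hF : ∀ ω, 0 ≤ F ω) (h : ∀ ω ∈ s, a ≤ F ω) : a * wProb W s ≤ wMean W F := by
  rw [wProb, ← wMean_const_mul]
  refine hW.wMean_mono fun ω => ?_
  by_cases hω : ω ∈ s
  · simpa [hω] using h ω hω
  · simpa [hω] using hF ω

theorem IsProbWeight.wMean_mul_sq_le {W : Ω → ℝ} (hW : IsProbWeight W) (F G : Ω → ℝ) :
    wMean W (fun ω => F ω * G ω) ^ 2 ≤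
      wMean W (fun ω => F ω ^ 2) * wMean W (fun ω => G ω ^ 2) := by
  have h := sum_mul_sq_le_sq_mul_sq univ (fun ω => √(W ω) * F ω) (fun ω => √(W ω) * G ω)
  have e : ∀ ω, √(W ω) * √(W ω) = W ω := fun ω => Real.mul_self_sqrt (hW.nonneg ω)
  simp only [wMean]
  calc (∑ ω, W ω * (F ω * G ω)) ^ 2
      = (∑ ω, √(W ω) * F ω * (√(W ω) * G ω)) ^ 2 := by
        congr 1; refine sum_congr rfl fun ω _ => ?_; linear_combination -(F ω * G ω) * e ω
    _ ≤ _ := h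
    _ = _ := by
        congr 1 <;> refine sum_congr rfl fun ω _ => ?_ <;> rw [mul_pow, sq (√(W ω)), e]

/-- A form of the Paley–Zygmund inequality. -/
theorem IsProbWeight.paley_zygmund {W : Ω → ℝ} (hW : IsProbWeight W) (X : Ω → ℝ) {m v : ℝ}
    (hm : 0 ≤ m) (hv : 0 < v) (h1 : m ≤ wMean W X) (h2 : wMean W (fun ω => X ω ^ 2) ≤ v) :
    m ^ 2 / (4 * v) ≤ wProb W {ω | m / 2 ≤ X ω} := by
  set l := m / v with hl
  have hl0 : 0 ≤ l := by positivity
  -- A quadratic lying below the indicator of X ≥ m/2 pointwise; l = m/v maximises the lower bound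
  -- obtained for its mean.
  have key : wMean W (fun ω => l * X ω - (l * (m / 2) + l ^ 2 / 4 * X ω ^ 2)) ≤
      wProb W {ω | m / 2 ≤ X ω} := by
    refine hW.wMean_mono fun ω => ?_
    by_cases hω : m / 2 ≤ X ω
    · rw [Set.indicator_of_mem (by exact hω)]
      nlinarith [sq_nonneg (1 - l * X ω / 2), mul_nonneg hl0 hm]
    · rw [Set.indicator_of_notMem (by exact hω)]
      push Not at hω
      nlinarith [mul_nonneg hl0 (sub_nonneg.2 hω.le), sq_nonneg (l * X ω)]
  rw [wMean_sub, wMean_add, hW.wMean_const, wMean_const_mul, wMean_const_mul] at key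
  have h3 : l ^ 2 / 4 * wMean W (fun ω => X ω ^ 2) ≤ l ^ 2 / 4 * v := by gcongr
  have h4 : l * m ≤ l * wMean W X := by gcongr
  have h5 : m ^ 2 / (4 * v) = l * m - (l * (m / 2) + l ^ 2 / 4 * v) := by
    rw [hl]; field_simp; ring
  linarith

/-- A mean zero function with comparable second and fourth moments is nonnegative with
probability bounded from below. -/
theorem IsProbWeight.wProb_nonneg_ge {W : Ω → ℝ} (hW : IsProbWeight W) (h : Ω → ℝ) {κ : ℝ}
    (hκ : 1 ≤ κ) (h0 : wMean W h = 0)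
    (h4 : wMean W (fun ω => h ω ^ 4) ≤ κ * wMean W (fun ω => h ω ^ 2) ^ 2) :
    1 / (4 * κ) ≤ wProb W {ω | 0 ≤ h ω} := by
  set s := wMean W (fun ω => h ω ^ 2) with hs
  have hs0 : 0 ≤ s := hW.wMean_nonneg fun ω => sq_nonneg _
  rcases hs0.eq_or_lt with hs1 | hs1
  · have hz : ∀ ω, W ω * h ω ^ 2 = 0 := by
      have := (sum_eq_zero_iff_of_nonneg (s := univ) (f := fun ω => W ω * h ω ^ 2)
        fun ω _ => mul_nonneg (hW.nonneg ω) (sq_nonneg _)).1 hs1.symm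
      simpa using this
    have : wProb W {ω | 0 ≤ h ω} = 1 := by
      rw [← hW.sum_eq_one]
      refine sum_congr rfl fun ω _ => ?_
      rcases mul_eq_zero.1 (hz ω) with h' | h'
      · simp [h']
      · have : h ω = 0 := by simpa using h'
        simp [this]
    rw [this, div_le_one (by positivity)]
    linarith
  · set a := (√(κ * s))⁻¹ with ha
    have ha2 : a ^ 2 = (κ * s)⁻¹ := by
      rw [ha, inv_pow, Real.sq_sqrt (by positivity)]
    -- With y = a h, the quartic (2y + 2y² - y⁴)/4 is at most 1 for y ≥ 0 and at most 0 for y ≤ 0.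
    -- Its linear term has mean zero, and the choice of a leaves 1/(2κ) - 1/(4κ).
    have key : wMean W (fun ω => (a / 2) * h ω + (a ^ 2 / 2 * h ω ^ 2 - a ^ 4 / 4 * h ω ^ 4)) ≤
        wProb W {ω | 0 ≤ h ω} := by
      have ha0 : 0 ≤ a := by positivity
      refine hW.wMean_mono fun ω => ?_
      have e : (a / 2) * h ω + (a ^ 2 / 2 * h ω ^ 2 - a ^ 4 / 4 * h ω ^ 4) =
        (2 * (a * h ω) + 2 * (a * h ω) ^ 2 - (a * h ω) ^ 4) / 4 := by ring
      rw [e]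
      by_cases hω : 0 ≤ h ω
      · rw [Set.indicator_of_mem (by exact hω)]
        have hy : 0 ≤ a * h ω := by positivity
        generalize a * h ω = y at hy
        nlinarith [sq_nonneg (y ^ 2 - 3 / 2), sq_nonneg (y - 1), sq_nonneg (y - 5 / 4)]
      · rw [Set.indicator_of_notMem (by exact hω)]
        push Not at hω
        have hy : a * h ω ≤ 0 := mul_nonpos_of_nonneg_of_nonpos ha0 hω.le
        generalize a * h ω = y at hy
        have h1 : 0 ≤ 2 + 2 * y - y ^ 3 := by
          nlinarith [sq_nonneg (y + 1), mul_nonneg (neg_nonneg.2 hy) (sq_nonneg (y + 1)),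
            mul_nonneg (neg_nonneg.2 hy) (sq_nonneg y)]
        nlinarith [mul_nonneg (neg_nonneg.2 hy) h1]
    rw [wMean_add, wMean_sub, wMean_const_mul, wMean_const_mul, wMean_const_mul, h0, ← hs] at key
    have h5 : a ^ 4 / 4 * wMean W (fun ω => h ω ^ 4) ≤ a ^ 4 / 4 * (κ * s ^ 2) := by gcongr
    have h6 : a ^ 4 = (κ * s)⁻¹ ^ 2 := by rw [← ha2]; ring
    have h7 : a ^ 2 / 2 * s - a ^ 4 / 4 * (κ * s ^ 2) = 1 / (4 * κ) := by
      rw [h6, ha2]; field_simp; ring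
    linarith

end FiniteExpectation

/-! ### Product weights: independence, resampling, images. -/

section ProductWeight

variable {ι R : Type*} [Fintype ι]

/-- The product weight on `ι → R`. -/
noncomputable def prodWeight (w : ι → R → ℝ) (ω : ι → R) : ℝ := ∏ i, w i (ω i)

variable [DecidableEq ι] [Fintype R]

theorem sum_prod_apply (g : ι → R → ℝ) :
    ∑ ω : ι → R, ∏ i, g i (ω i) = ∏ i, ∑ r, g i r := by
  rw [prod_univ_sum, Fintype.piFinset_univ]

theorem isProbWeight_prodWeight {w : ι → R → ℝ} (hw : ∀ i, IsProbWeight (w i)) :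
    IsProbWeight (prodWeight w) where
  nonneg ω := prod_nonneg fun i _ => (hw i).nonneg _
  sum_eq_one := by
    simp only [prodWeight, sum_prod_apply, (hw _).sum_eq_one, prod_const_one]

theorem wMean_prodWeight_prod {w : ι → R → ℝ} (hw : ∀ i, IsProbWeight (w i))
    (φ : ι → R → ℝ) (S : Finset ι) :
    wMean (prodWeight w) (fun ω => ∏ i ∈ S, φ i (ω i)) = ∏ i ∈ S, wMean (w i) (φ i) := by
  have h : ∀ ω : ι → R, prodWeight w ω * ∏ i ∈ S, φ i (ω i) =
      ∏ i, w i (ω i) * (if i ∈ S then φ i (ω i) else 1) := fun ω => by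
    rw [prod_mul_distrib, prod_ite_mem, univ_inter, prodWeight]
  simp only [wMean, h]
  rw [sum_prod_apply (fun i r => w i r * (if i ∈ S then φ i r else 1)),
    ← Finset.univ_inter S, ← prod_ite_mem]
  refine prod_congr rfl fun i _ => ?_
  by_cases hi : i ∈ S <;> simp [hi, (hw i).sum_eq_one]

/-- Resampling a coordinate does not change the expectation. -/
theorem wMean_prodWeight_resample {w : ι → R → ℝ} (hw : ∀ i, IsProbWeight (w i)) (a : ι)
    (F : (ι → R) → ℝ) :
    wMean (prodWeight w) F =
      wMean (prodWeight w) (fun ω => ∑ r, w a r * F (Function.update ω a r)) := by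
  have hl : wMean (prodWeight w) F =
      ∑ x : (ι → R) × R, prodWeight w x.1 * w a x.2 * F x.1 := by
    rw [Fintype.sum_prod_type]
    refine sum_congr rfl fun ω _ => ?_
    simp only [← sum_mul, ← mul_sum, (hw a).sum_eq_one, mul_one]
  have hr : wMean (prodWeight w) (fun ω => ∑ r, w a r * F (Function.update ω a r)) =
      ∑ x : (ι → R) × R, prodWeight w x.1 * w a x.2 * F (Function.update x.1 a x.2) := by
    rw [Fintype.sum_prod_type]
    simp only [wMean, mul_sum, mul_assoc]
  -- Exchanging the coordinate at `a` with the fresh sample is an involution that preserves the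
  -- joint weight.
  have hinv : Function.Involutive
      (fun x : (ι → R) × R => (Function.update x.1 a x.2, x.1 a)) := fun x => by simp
  rw [hl, hr]
  refine (Fintype.sum_equiv hinv.toPerm _ _ fun x => ?_).symm
  simp only [Function.Involutive.coe_toPerm, prodWeight]
  congr 1
  rw [← mul_prod_erase univ _ (mem_univ a), ← mul_prod_erase univ _ (mem_univ a)]
  have : ∏ i ∈ univ.erase a, w i (Function.update x.1 a x.2 i) =
      ∏ i ∈ univ.erase a, w i (x.1 i) :=
    prod_congr rfl fun i hi => by rw [Function.update_of_ne (ne_of_mem_erase hi)]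
  rw [this, Function.update_self]
  ring

theorem wMean_prodWeight_mul {w : ι → R → ℝ} (hw : ∀ i, IsProbWeight (w i)) (a : ι)
    {H : (ι → R) → ℝ} (hH : ∀ ω r, H (Function.update ω a r) = H ω) (φ : R → ℝ) :
    wMean (prodWeight w) (fun ω => H ω * φ (ω a)) =
      wMean (prodWeight w) H * wMean (w a) φ := by
  rw [wMean_prodWeight_resample hw a, ← wMean_mul_const]
  congr 1
  funext ω
  simp only [hH, Function.update_self, wMean, mul_sum]
  exact sum_congr rfl fun r _ => by ring

/-- The image of a product weight under a coordinatewise map. -/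
theorem wMean_prodWeight_map {V : Type*} [Fintype V] [DecidableEq V] {w : ι → R → ℝ}
    {p : ι → V → ℝ} (φ : R → V) (hφ : ∀ i x, ∑ r with φ r = x, w i r = p i x)
    (H : (ι → V) → ℝ) :
    wMean (prodWeight w) (fun ω => H (fun i => φ (ω i))) = wMean (prodWeight p) H := by
  have hp : ∀ x : ι → V, prodWeight p x =
      ∑ ω : ι → R, ∏ i, if φ (ω i) = x i then w i (ω i) else 0 := fun x => by
    rw [sum_prod_apply (fun i r => if φ r = x i then w i r else 0), prodWeight]
    exact prod_congr rfl fun i _ => by rw [← hφ, sum_filter]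
  simp only [wMean, hp, sum_mul]
  rw [sum_comm]
  refine sum_congr rfl fun ω _ => ?_
  rw [Fintype.sum_eq_single (fun i => φ (ω i))]
  · simp [prodWeight]
  · intro x hx
    obtain ⟨i, hi⟩ := Function.ne_iff.1 hx
    rw [prod_eq_zero (mem_univ i), zero_mul]
    rw [if_neg (Ne.symm hi)]

end ProductWeight

/-! ### Multi-affine functions of independent variables and (2,4)-hypercontractivity. -/

section MultiAffine

variable {ι : Type*}

/-- The multi-affine function with coefficients `c` in the variables indexed by `s`. -/
noncomputable def multiAffine (c : Finset ι → ℝ) (s : Finset ι) (Z : ι → ℝ) : ℝ :=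
  ∑ S ∈ s.powerset, c S * ∏ i ∈ S, Z i

theorem multiAffine_congr (c : Finset ι → ℝ) {s : Finset ι} {Z Z' : ι → ℝ}
    (h : ∀ i ∈ s, Z i = Z' i) : multiAffine c s Z = multiAffine c s Z' :=
  sum_congr rfl fun S hS => by
    rw [prod_congr rfl fun i hi => h i (mem_powerset.1 hS hi)]

variable [DecidableEq ι]

theorem multiAffine_update {R : Type*} (c : Finset ι → ℝ) {s : Finset ι} {a : ι} (ha : a ∉ s)
    (Z : ι → R → ℝ) (ω : ι → R) (r : R) :
    multiAffine c s (fun i => Z i (Function.update ω a r i)) =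
      multiAffine c s (fun i => Z i (ω i)) :=
  multiAffine_congr c fun i hi => by
    rw [Function.update_of_ne (ne_of_mem_of_not_mem hi ha)]

/-- The induction step for moments: subtracting `m` lets the new variable be centred even when it
has nonzero mean. -/
theorem multiAffine_insert (c : Finset ι → ℝ) {s : Finset ι} {a : ι} (ha : a ∉ s) (m : ℝ)
    (Z : ι → ℝ) :
    multiAffine c (insert a s) Z =
      multiAffine (fun S => c S + m * c (insert a S)) s Z +
        (Z a - m) * multiAffine (fun S => c (insert a S)) s Z := by
  simp only [multiAffine]
  rw [sum_powerset_insert ha, mul_sum, ← sum_add_distrib, ← sum_add_distrib]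
  refine sum_congr rfl fun S hS => ?_
  rw [prod_insert fun h => ha (mem_powerset.1 hS h)]
  ring

variable {R : Type*} [Fintype ι] [Fintype R]

theorem wMean_multiAffine {w : ι → R → ℝ} (hw : ∀ i, IsProbWeight (w i)) (Z : ι → R → ℝ)
    (c : Finset ι → ℝ) (s : Finset ι) :
    wMean (prodWeight w) (fun ω => multiAffine c s (fun i => Z i (ω i))) =
      multiAffine c s (fun i => wMean (w i) (Z i)) := by
  simp only [multiAffine, wMean_sum, wMean_const_mul, wMean_prodWeight_prod hw]

theorem wMean_sq_add_mul {w : ι → R → ℝ} (hw : ∀ i, IsProbWeight (w i)) {a : ι} {φ : R → ℝ}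
    (hφ : wMean (w a) φ = 0) {F G : (ι → R) → ℝ}
    (hF : ∀ ω r, F (Function.update ω a r) = F ω)
    (hG : ∀ ω r, G (Function.update ω a r) = G ω) :
    wMean (prodWeight w) (fun ω => (F ω + φ (ω a) * G ω) ^ 2) =
      wMean (prodWeight w) (fun ω => F ω ^ 2) +
        wMean (w a) (fun r => φ r ^ 2) * wMean (prodWeight w) (fun ω => G ω ^ 2) := by
  have e : ∀ ω, (F ω + φ (ω a) * G ω) ^ 2 =
      F ω ^ 2 + (2 * F ω * G ω * φ (ω a) + G ω ^ 2 * φ (ω a) ^ 2) := fun ω => by ring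
  simp only [e, wMean_add]
  rw [wMean_prodWeight_mul hw a (H := fun ω => 2 * F ω * G ω) (by simp [hF, hG]) φ,
    wMean_prodWeight_mul hw a (H := fun ω => G ω ^ 2) (by simp [hG]) (fun r => φ r ^ 2), hφ]
  ring

/-- The second moment of a multi-affine function in independent centered variables. -/
theorem wMean_multiAffine_sq {w : ι → R → ℝ} (hw : ∀ i, IsProbWeight (w i)) {Z : ι → R → ℝ}
    (hZ : ∀ i, wMean (w i) (Z i) = 0) (s : Finset ι) (c : Finset ι → ℝ) :
    wMean (prodWeight w) (fun ω => multiAffine c s (fun i => Z i (ω i)) ^ 2) =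
      ∑ S ∈ s.powerset, c S ^ 2 * ∏ i ∈ S, wMean (w i) (fun r => Z i r ^ 2) := by
  induction s using Finset.induction_on generalizing c with
  | empty => simp [multiAffine, (isProbWeight_prodWeight hw).wMean_const]
  | insert a s ha ih =>
    simp only [multiAffine_insert c ha 0, sub_zero, zero_mul, add_zero]
    rw [wMean_sq_add_mul hw (hZ a)
      (F := fun ω => multiAffine c s (fun i => Z i (ω i)))
      (G := fun ω => multiAffine (fun S => c (insert a S)) s (fun i => Z i (ω i))) (fun ω r => multiAffine_update _ ha Z ω r)
      (fun ω r => multiAffine_update _ ha Z ω r), ih, ih, sum_powerset_insert ha, mul_sum]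
    congr 1
    refine sum_congr rfl fun S hS => ?_
    rw [prod_insert fun h => ha (mem_powerset.1 hS h)]
    ring

/-- The term with φ³ need not vanish in mean; 4FG³φ³ ≤ 2F²G²φ² + 2G⁴φ⁴ turns the binomial
coefficients 6 and 1 into 8 and 3. -/
theorem wMean_pow_four_add_mul_le {w : ι → R → ℝ} (hw : ∀ i, IsProbWeight (w i)) {a : ι}
    {φ : R → ℝ} (hφ : wMean (w a) φ = 0) {F G : (ι → R) → ℝ}
    (hF : ∀ ω r, F (Function.update ω a r) = F ω)
    (hG : ∀ ω r, G (Function.update ω a r) = G ω) :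
    wMean (prodWeight w) (fun ω => (F ω + φ (ω a) * G ω) ^ 4) ≤
      wMean (prodWeight w) (fun ω => F ω ^ 4) +
        (8 * wMean (w a) (fun r => φ r ^ 2) *
          wMean (prodWeight w) (fun ω => F ω ^ 2 * G ω ^ 2) +
        3 * wMean (w a) (fun r => φ r ^ 4) * wMean (prodWeight w) (fun ω => G ω ^ 4)) := by
  have e : ∀ ω, (F ω + φ (ω a) * G ω) ^ 4 ≤
      F ω ^ 4 + ((4 * F ω ^ 3 * G ω) * φ (ω a) + ((8 * (F ω ^ 2 * G ω ^ 2)) * φ (ω a) ^ 2 +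
        (3 * G ω ^ 4) * φ (ω a) ^ 4)) := fun ω => by
    nlinarith [sq_nonneg (φ (ω a) * F ω * G ω - φ (ω a) ^ 2 * G ω ^ 2)]
  refine ((isProbWeight_prodWeight hw).wMean_mono e).trans_eq ?_
  simp only [wMean_add]
  rw [wMean_prodWeight_mul hw a (H := fun ω => 4 * F ω ^ 3 * G ω) (by simp [hF, hG]) φ,
    wMean_prodWeight_mul hw a (H := fun ω => 8 * (F ω ^ 2 * G ω ^ 2)) (by simp [hF, hG])
      (fun r => φ r ^ 2),
    wMean_prodWeight_mul hw a (H := fun ω => 3 * G ω ^ 4) (by simp [hG]) (fun r => φ r ^ 4),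
    wMean_const_mul, wMean_const_mul, hφ]
  ring

/-- Hypercontractivity for multi-affine functions of bounded degree in independent variables. -/
theorem wMean_multiAffine_pow_four_le {w : ι → R → ℝ} (hw : ∀ i, IsProbWeight (w i))
    {Z : ι → R → ℝ} {B : ℝ} (hB : 1 ≤ B)
    (hZ : ∀ i, wMean (w i) (fun r => (Z i r - wMean (w i) (Z i)) ^ 4) ≤
      B * wMean (w i) (fun r => (Z i r - wMean (w i) (Z i)) ^ 2) ^ 2)
    (s : Finset ι) (d : ℕ) (c : Finset ι → ℝ) (hc : ∀ S ⊆ s, d < #S → c S = 0) :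
    wMean (prodWeight w) (fun ω => multiAffine c s (fun i => Z i (ω i)) ^ 4) ≤
      (16 * B) ^ d *
        wMean (prodWeight w) (fun ω => multiAffine c s (fun i => Z i (ω i)) ^ 2) ^ 2 := by
  have hW := isProbWeight_prodWeight hw
  induction s using Finset.induction_on generalizing c d with
  | empty =>
    simp only [multiAffine, powerset_empty, sum_singleton, prod_empty, mul_one, hW.wMean_const]
    nlinarith [one_le_pow₀ (n := d) (show 1 ≤ 16 * B by linarith), sq_nonneg (c ∅ ^ 2)]
  | insert a s ha ih =>
    set m := wMean (w a) (Z a) with hm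
    have hφ : wMean (w a) (fun r => Z a r - m) = 0 := by
      rw [wMean_sub, (hw a).wMean_const, hm, sub_self]
    have hF := fun ω r => multiAffine_update (fun S => c S + m * c (insert a S)) ha Z ω r
    have hG := fun ω r => multiAffine_update (fun S => c (insert a S)) ha Z ω r
    simp only [multiAffine_insert c ha m]
    have hc0 : ∀ S ⊆ s, d < #S → c S + m * c (insert a S) = 0 := fun S hS hd => by
      rw [hc S (hS.trans (subset_insert a s)) hd, hc (insert a S) (insert_subset_insert a hS)
        (hd.trans_le (card_le_card (subset_insert a S)))]
      simp
    have i0 := ih d _ hc0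
    cases d with
    | zero =>
      have hz : ∀ Z' : ι → ℝ, multiAffine (fun S => c (insert a S)) s Z' = 0 := fun Z' =>
        sum_eq_zero fun S hS => by
          have := hc _ (insert_subset_insert a (mem_powerset.1 hS))
            (card_pos.2 (insert_nonempty a S))
          simp [this]
      simpa only [hz, mul_zero, add_zero] using i0
    | succ d =>
      -- The cofactor of the new variable has degree one less, which saves one factor 16B.
      have i1 := ih d (fun S => c (insert a S)) fun S hS hd =>
        hc _ (insert_subset_insert a hS) (by
          rw [card_insert_of_notMem fun h => ha (hS h)]; lia)
      have q4 := wMean_pow_four_add_mul_le hw hφ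
        (F := fun ω => multiAffine (fun S => c S + m * c (insert a S)) s (fun i => Z i (ω i)))
        (G := fun ω => multiAffine (fun S => c (insert a S)) s (fun i => Z i (ω i))) hF hG
      have q2 := wMean_sq_add_mul hw hφ
        (F := fun ω => multiAffine (fun S => c S + m * c (insert a S)) s (fun i => Z i (ω i)))
        (G := fun ω => multiAffine (fun S => c (insert a S)) s (fun i => Z i (ω i))) hF hG
      have cs := hW.wMean_mul_sq_le
        (fun ω => multiAffine (fun S => c S + m * c (insert a S)) s (fun i => Z i (ω i)) ^ 2)
        (fun ω => multiAffine (fun S => c (insert a S)) s (fun i => Z i (ω i)) ^ 2)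
      simp only [← pow_mul] at cs
      norm_num only at cs
      rw [q2]
      refine q4.trans ?_
      have hk := hZ a
      rw [← hm] at hk
      have n1 : 0 ≤ wMean (w a) (fun r => (Z a r - m) ^ 2) :=
        (hw a).wMean_nonneg fun r => sq_nonneg _
      have n2 : 0 ≤ wMean (prodWeight w) (fun ω =>
          multiAffine (fun S => c S + m * c (insert a S)) s (fun i => Z i (ω i)) ^ 2) :=
        hW.wMean_nonneg fun r => sq_nonneg _
      have n3 : 0 ≤ wMean (prodWeight w) (fun ω =>
          multiAffine (fun S => c (insert a S)) s (fun i => Z i (ω i)) ^ 2) :=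
        hW.wMean_nonneg fun r => sq_nonneg _
      have n4 : 0 ≤ wMean (prodWeight w) (fun ω =>
          multiAffine (fun S => c (insert a S)) s (fun i => Z i (ω i)) ^ 4) :=
        hW.wMean_nonneg fun r => by positivity
      generalize wMean (prodWeight w) (fun ω =>
          multiAffine (fun S => c S + m * c (insert a S)) s (fun i => Z i (ω i)) ^ 2) = x2 at *
      generalize wMean (prodWeight w) (fun ω =>
          multiAffine (fun S => c (insert a S)) s (fun i => Z i (ω i)) ^ 2) = y2 at *
      generalize wMean (prodWeight w) (fun ω =>
          multiAffine (fun S => c (insert a S)) s (fun i => Z i (ω i)) ^ 4) = y4 at *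
      generalize wMean (prodWeight w) (fun ω =>
          multiAffine (fun S => c S + m * c (insert a S)) s (fun i => Z i (ω i)) ^ 4) = x4 at *
      generalize wMean (prodWeight w) (fun ω =>
          multiAffine (fun S => c S + m * c (insert a S)) s (fun i => Z i (ω i)) ^ 2 *
          multiAffine (fun S => c (insert a S)) s (fun i => Z i (ω i)) ^ 2) = xy at *
      generalize wMean (w a) (fun r => (Z a r - m) ^ 2) = k2 at *
      generalize wMean (w a) (fun r => (Z a r - m) ^ 4) = k4 at *
      have hK0 : (0 : ℝ) < (16 * B) ^ d := by positivity
      rw [pow_succ] at i0 ⊢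
      generalize (16 * B) ^ d = K at *
      -- Cauchy–Schwarz gives the factor √(16B) ≤ 4B, so 8·k2·xy fits exactly into the cross term of
      -- (x2 + k2·y2)².
      have hxy : xy ≤ K * (16 * B) * x2 * y2 / 4 := by
        refine le_of_sq_le_sq ?_ (by positivity)
        calc xy ^ 2 ≤ x4 * y4 := cs
          _ ≤ (K * (16 * B) * x2 ^ 2) * (K * y2 ^ 2) := by gcongr
          _ ≤ (K * (16 * B) * x2 ^ 2) * (K * y2 ^ 2) * B := le_mul_of_one_le_right (by positivity) hB
          _ = _ := by ring
      have h1 : 8 * k2 * xy ≤ 8 * k2 * (K * (16 * B) * x2 * y2 / 4) := by gcongr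
      have h2 : 3 * k4 * y4 ≤ 3 * (B * k2 ^ 2) * (K * y2 ^ 2) := by gcongr
      have h3 : 0 ≤ K * B * (k2 * y2) ^ 2 := by positivity
      nlinarith

/-- Subtracting the mean, with the sign of the mean factored out, gives a centred function of the
same degree; where it is nonnegative the value lies beyond the mean. -/
theorem wProb_multiAffine_abs_ge {w : ι → R → ℝ} (hw : ∀ i, IsProbWeight (w i))
    {Z : ι → R → ℝ} {B : ℝ} (hB : 1 ≤ B)
    (hZ : ∀ i, wMean (w i) (fun r => (Z i r - wMean (w i) (Z i)) ^ 4) ≤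
      B * wMean (w i) (fun r => (Z i r - wMean (w i) (Z i)) ^ 2) ^ 2)
    (s : Finset ι) (d : ℕ) (c : Finset ι → ℝ) (hc : ∀ S ⊆ s, d < #S → c S = 0) {t : ℝ}
    (ht : t ≤ |wMean (prodWeight w) (fun ω => multiAffine c s (fun i => Z i (ω i)))|) :
    1 / (4 * (16 * B) ^ d) ≤
      wProb (prodWeight w) {ω | t ≤ |multiAffine c s (fun i => Z i (ω i))|} := by
  have hW := isProbWeight_prodWeight hw
  set e := wMean (prodWeight w) (fun ω => multiAffine c s (fun i => Z i (ω i))) with he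
  obtain ⟨σ, hσ, hσe⟩ : ∃ σ : ℝ, |σ| = 1 ∧ |e| = σ * e := by
    rcases abs_cases e with h | h
    · exact ⟨1, by simp, by simp [h.1]⟩
    · exact ⟨-1, by simp, by simp [h.1]⟩
  set c' : Finset ι → ℝ := fun S => σ * (c S - if S = ∅ then e else 0) with hc'
  have hdec : ∀ Y : ι → ℝ, multiAffine c' s Y = σ * (multiAffine c s Y - e) := fun Y => by
    simp only [multiAffine, hc', mul_assoc, sub_mul, ite_mul, zero_mul, ← mul_sum,
      sum_sub_distrib]
    rw [sum_ite_eq' s.powerset ∅ (fun S => e * ∏ i ∈ S, Y i)]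
    simp
  have key := hW.wProb_nonneg_ge (fun ω => multiAffine c' s (fun i => Z i (ω i)))
    (κ := (16 * B) ^ d) (one_le_pow₀ (by linarith)) (by
      simp only [hdec, wMean_const_mul, wMean_sub, hW.wMean_const, ← he, sub_self, mul_zero])
    (wMean_multiAffine_pow_four_le hw hB hZ s d c' fun S hS hd => by
      have : S ≠ ∅ := by rintro rfl; simp at hd
      simp [hc', hc S hS hd, this])
  refine key.trans (hW.wProb_mono fun ω hω => ?_)
  simp only [Set.mem_ofPred_eq, hdec] at hω ⊢
  calc t ≤ |e| := ht
    _ = σ * e := hσe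
    _ ≤ σ * multiAffine c s (fun i => Z i (ω i)) := by linarith
    _ ≤ |σ * multiAffine c s (fun i => Z i (ω i))| := le_abs_self _
    _ = _ := by rw [abs_mul, hσ, one_mul]

end MultiAffine

/-! ### Lower bounds for tails of Rademacher sums. -/

section Rademacher

/-- The sign of a Boolean. -/
def boolSign (b : Bool) : ℝ := if b then 1 else -1

@[simp] theorem boolSign_true : boolSign true = 1 := rfl

@[simp] theorem boolSign_false : boolSign false = -1 := rfl

theorem boolSign_not (b : Bool) : boolSign (!b) = -boolSign b := by cases b <;> simp

/-- The uniform weight on the Booleans. -/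
noncomputable def coin (_ : Bool) : ℝ := 1 / 2

theorem isProbWeight_coin : IsProbWeight coin where
  nonneg _ := by norm_num [coin]
  sum_eq_one := by norm_num [coin]

/-- With y = x²/4 ≤ 1, exp y ≤ 1 + y + y² ≤ 1 + 2y, which is the start of the series of cosh x. -/
theorem Real.exp_sq_div_four_le_cosh {x : ℝ} (hx : |x| ≤ 2) :
    Real.exp (x ^ 2 / 4) ≤ Real.cosh x := by
  have h1 : x ^ 2 / 4 ≤ 1 := by nlinarith [sq_abs x, abs_nonneg x]
  have h0 : 0 ≤ x ^ 2 / 4 := by positivity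
  have h2 := (abs_le.1 (Real.abs_exp_sub_one_sub_id_le (abs_le.2 ⟨by linarith, h1⟩))).2
  have h3 : 1 + x ^ 2 / 2 ≤ Real.cosh x := by
    have hs := (Real.hasSum_cosh x).summable
    have := hs.sum_le_tsum (range 2) fun n _ => by
      rw [pow_mul]; positivity
    rw [(Real.hasSum_cosh x).tsum_eq] at this
    simpa [sum_range_succ] using this
  nlinarith

variable {ι : Type*} [Fintype ι] [DecidableEq ι]

theorem wMean_coin_exp (a : ι → ℝ) (G : Finset ι) :
    wMean (prodWeight fun _ : ι => coin)
      (fun σ => Real.exp (∑ i ∈ G, a i * boolSign (σ i))) = ∏ i ∈ G, Real.cosh (a i) := by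
  simp only [Real.exp_sum]
  rw [wMean_prodWeight_prod (fun _ => isProbWeight_coin)
    (fun i b => Real.exp (a i * boolSign b))]
  refine prod_congr rfl fun i _ => ?_
  simp [wMean, coin, Real.cosh_eq]
  ring

/-- A lower bound on the upper tail of a Rademacher sum with small coefficients. -/
theorem wProb_rademacher_ge (a : ι → ℝ) (G : Finset ι) {T : ℝ} (hT : 0 < T)
    (hA : 0 < ∑ i ∈ G, a i ^ 2) (hTA : ∑ i ∈ G, a i ^ 2 ≤ T ^ 2)
    (ha : ∀ i ∈ G, 4 * T * |a i| ≤ ∑ i ∈ G, a i ^ 2) :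
    Real.exp (-(96 * T ^ 2 / ∑ i ∈ G, a i ^ 2)) / 4 ≤
      wProb (prodWeight fun _ : ι => coin) {σ | T ≤ ∑ i ∈ G, a i * boolSign (σ i)} := by
  have hW := isProbWeight_prodWeight (fun _ : ι => isProbWeight_coin)
  set A := ∑ i ∈ G, a i ^ 2 with hAdef
  -- Paley–Zygmund is applied to exp(lY). The smallness of the a_i gives l|a_i| ≤ 2, so the first
  -- moment is at least exp(l²A/4) and the second at most exp(2l²A); the loss exp(-3l²A/2) is
  -- exp(-96T²/A). Half the first moment already forces Y ≥ T.
  set l := 8 * T / A with hl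
  have hl0 : 0 < l := by positivity
  have h1 : Real.exp (l ^ 2 * A / 4) ≤ wMean (prodWeight fun _ : ι => coin)
      (fun σ => Real.exp (∑ i ∈ G, (l * a i) * boolSign (σ i))) := by
    rw [wMean_coin_exp, hAdef, mul_sum, sum_div, Real.exp_sum]
    refine prod_le_prod (fun i _ => (Real.exp_pos _).le) fun i hi => ?_
    rw [← mul_pow]
    refine Real.exp_sq_div_four_le_cosh ?_
    rw [abs_mul, abs_of_pos hl0, hl, div_mul_eq_mul_div, div_le_iff₀ hA]
    linarith [ha i hi]
  have h2 : wMean (prodWeight fun _ : ι => coin)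
      (fun σ => Real.exp (∑ i ∈ G, (l * a i) * boolSign (σ i)) ^ 2) ≤
        Real.exp (2 * l ^ 2 * A) := by
    have e : ∀ σ : ι → Bool, Real.exp (∑ i ∈ G, (l * a i) * boolSign (σ i)) ^ 2 =
        Real.exp (∑ i ∈ G, (2 * l * a i) * boolSign (σ i)) := fun σ => by
      rw [← Real.exp_nat_mul, mul_sum]
      congr 1
      exact sum_congr rfl fun i _ => by push_cast; ring
    simp only [e]
    rw [wMean_coin_exp, hAdef, mul_sum, Real.exp_sum]
    refine prod_le_prod (fun i _ => (Real.cosh_pos _).le) fun i hi => ?_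
    refine (Real.cosh_le_exp_half_sq _).trans_eq ?_
    congr 1
    ring
  have key := hW.paley_zygmund _ (Real.exp_pos _).le (Real.exp_pos _) h1 h2
  have e1 : Real.exp (l ^ 2 * A / 4) ^ 2 / (4 * Real.exp (2 * l ^ 2 * A)) =
      Real.exp (-(96 * T ^ 2 / A)) / 4 := by
    rw [← Real.exp_nat_mul, mul_comm 4, ← div_div, ← Real.exp_sub]
    congr 2
    rw [hl]
    field_simp
    norm_num
  rw [e1] at key
  refine key.trans (hW.wProb_mono fun σ hσ => ?_)
  simp only [Set.mem_ofPred_eq, mul_assoc, ← mul_sum] at hσ ⊢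
  set Y := ∑ i ∈ G, a i * boolSign (σ i)
  have h3 : l ^ 2 * A / 4 - Real.log 2 ≤ l * Y := by
    rw [← Real.exp_le_exp, Real.exp_sub, Real.exp_log two_pos]
    exact hσ
  have h4 : l * Y * A = 8 * T * Y := by rw [hl]; field_simp
  have h5 : l ^ 2 * A / 4 * A = 16 * T ^ 2 := by rw [hl]; field_simp; norm_num
  have h6 : (l ^ 2 * A / 4 - Real.log 2) * A ≤ l * Y * A := by gcongr
  have h7 : Real.log 2 * A ≤ 1 * T ^ 2 := by
    gcongr
    linarith [Real.log_two_lt_d9]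
  have h8 : T * (8 * T) ≤ Y * (8 * T) := by nlinarith
  exact le_of_mul_le_mul_right h8 (by positivity)

/-- Adding independent symmetric noise decreases a tail by at most a factor of `2`. -/
theorem wProb_rademacher_subset_le (a : ι → ℝ) (G : Finset ι) (T : ℝ) :
    wProb (prodWeight fun _ : ι => coin) {σ | T ≤ ∑ i ∈ G, a i * boolSign (σ i)} ≤
      2 * wProb (prodWeight fun _ : ι => coin) {σ | T ≤ ∑ i, a i * boolSign (σ i)} := by
  have hW := isProbWeight_prodWeight (fun _ : ι => isProbWeight_coin)
  -- Flipping the signs outside G preserves the uniform law, and the sum over G is the average of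
  -- the full sums before and after; one of them is at least T whenever the sum over G is.
  set flip : (ι → Bool) → ι → Bool := fun σ i => if i ∈ G then σ i else !σ i with hflip
  have hinv : Function.Involutive flip := fun σ => by
    funext i; by_cases hi : i ∈ G <;> simp [hflip, hi]
  have hsplit : ∀ σ : ι → Bool, ∑ i, a i * boolSign (σ i) =
      ∑ i ∈ G, a i * boolSign (σ i) + ∑ i ∈ Gᶜ, a i * boolSign (σ i) := fun σ =>
    (sum_add_sum_compl G _).symm
  have hf : ∀ σ : ι → Bool, ∑ i, a i * boolSign (flip σ i) =
      ∑ i ∈ G, a i * boolSign (σ i) - ∑ i ∈ Gᶜ, a i * boolSign (σ i) := fun σ => by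
    rw [hsplit (flip σ), sub_eq_add_neg, ← sum_neg_distrib]
    congr 1
    · exact sum_congr rfl fun i hi => by simp [hflip, hi]
    · exact sum_congr rfl fun i hi => by
        simp [hflip, mem_compl.1 hi, boolSign_not]
  have e : wProb (prodWeight fun _ : ι => coin) {σ | T ≤ ∑ i, a i * boolSign (flip σ i)} =
      wProb (prodWeight fun _ : ι => coin) {σ | T ≤ ∑ i, a i * boolSign (σ i)} := by
    refine Fintype.sum_equiv hinv.toPerm _ _ fun σ => ?_
    simp [prodWeight, coin, Set.indicator_apply]
  rw [two_mul]
  nth_rw 1 [← e]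
  rw [wProb, wProb, wProb, ← wMean_add]
  refine hW.wMean_mono fun σ => ?_
  simp only [Set.indicator_apply, Set.mem_ofPred_eq, hf, hsplit]
  split_ifs <;> linarith

theorem wProb_rademacher_abs_ge (a : ι → ℝ) (G : Finset ι) {T A : ℝ} (hT : 0 < T)
    (hA : 0 < A) (hAG : A ≤ ∑ i ∈ G, a i ^ 2) (hTA : A ≤ T ^ 2)
    (ha : ∀ i ∈ G, 4 * T * |a i| ≤ A) :
    Real.exp (-(96 * T ^ 2 / A)) / 8 ≤
      wProb (prodWeight fun _ : ι => coin) {σ | T ≤ |∑ i, a i * boolSign (σ i)|} := by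
  have hW := isProbWeight_prodWeight (fun _ : ι => isProbWeight_coin)
  set A' := ∑ i ∈ G, a i ^ 2 with hA'
  -- The actual square sum A' may exceed T², which the previous bound excludes; raising the
  -- threshold to √A' restores its hypothesis and keeps T'²/A' ≤ T²/A.
  set T' := max T (√A') with hT'
  have hA'0 : 0 < A' := hA.trans_le hAG
  have hsq : √A' ^ 2 = A' := Real.sq_sqrt hA'0.le
  have hTT : T ≤ T' := le_max_left _ _
  have h1 := wProb_rademacher_ge a G (T := T') (hT.trans_le hTT) hA'0
    (by rw [← hA', ← hsq]; exact pow_le_pow_left₀ (by positivity) (le_max_right _ _) 2)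
    (fun i hi => by
      rw [← hA']
      rcases le_total T (√A') with h | h
      · rw [hT', max_eq_right h]
        have h2 : (4 * |a i|) ≤ √A' := by
          refine le_of_mul_le_mul_left ?_ hT
          nlinarith [ha i hi, Real.sqrt_nonneg A', Real.sqrt_le_sqrt hAG, Real.sq_sqrt hA.le,
            Real.sqrt_nonneg A, abs_nonneg (a i), Real.sqrt_le_iff.2 ⟨hT.le, hTA⟩]
        nlinarith [Real.sqrt_nonneg A']
      · rw [hT', max_eq_left h]
        exact (ha i hi).trans hAG)
  have h2 : T' ^ 2 / A' ≤ T ^ 2 / A := by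
    rcases le_total T (√A') with h | h
    · rw [hT', max_eq_right h, hsq, div_self hA'0.ne', one_le_div hA]
      exact hTA
    · rw [hT', max_eq_left h]
      gcongr
  have h3 : Real.exp (-(96 * T ^ 2 / A)) ≤ Real.exp (-(96 * T' ^ 2 / A')) := by
    rw [Real.exp_le_exp, neg_le_neg_iff, mul_div_assoc, mul_div_assoc]
    linarith
  have h4 := wProb_rademacher_subset_le a G T'
  have h5 : wProb (prodWeight fun _ : ι => coin) {σ | T' ≤ ∑ i, a i * boolSign (σ i)} ≤
      wProb (prodWeight fun _ : ι => coin) {σ | T ≤ |∑ i, a i * boolSign (σ i)|} :=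
    hW.wProb_mono fun σ hσ => hTT.trans (hσ.trans (le_abs_self _))
  linarith

end Rademacher

/-! ### A discrete Bernstein inequality from Fejér-kernel quadrature. -/

section Bernstein

theorem sum_cexp_equidistributed {N : ℕ} {n : ℤ} (hn : |n| < N) :
    ∑ j ∈ range N, Complex.exp (n * ((2 * Real.pi * j / N : ℝ) : ℂ) * Complex.I) =
      if n = 0 then (N : ℂ) else 0 := by
  have hN : (N : ℂ) ≠ 0 := by
    have : 0 < (N : ℤ) := (abs_nonneg n).trans_lt hn
    exact_mod_cast this.ne'
  split_ifs with h
  · simp [h]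
  set r := Complex.exp (2 * Real.pi * Complex.I * (n / N)) with hr
  have hterm : ∀ j : ℕ, Complex.exp (n * ((2 * Real.pi * j / N : ℝ) : ℂ) * Complex.I) = r ^ j :=
    fun j => by
      rw [hr, ← Complex.exp_nat_mul]
      congr 1
      push_cast
      ring
  have hrN : r ^ N = 1 := by
    rw [hr, ← Complex.exp_nat_mul, Complex.exp_eq_one_iff]
    exact ⟨n, by field_simp⟩
  have hr1 : r ≠ 1 := fun h1 => by
    rw [hr, Complex.exp_eq_one_iff] at h1
    obtain ⟨k, hk⟩ := h1
    have hpi : (2 * Real.pi * Complex.I : ℂ) ≠ 0 := by simp [Real.pi_ne_zero]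
    rw [mul_comm] at hk
    have h2 : (n : ℂ) = k * N := by
      have := mul_right_cancel₀ hpi hk
      rwa [div_eq_iff hN] at this
    have h3 : n = k * N := by exact_mod_cast h2
    have hk0 : k ≠ 0 := by rintro rfl; simp at h3; exact h h3
    have : (1 : ℤ) ≤ |k| := Int.one_le_abs hk0
    rw [h3, abs_mul, Nat.abs_cast] at hn
    nlinarith
  simp only [hterm]
  rw [geom_sum_eq hr1, hrN, sub_self, zero_div]

/-- The unnormalized Fejér kernel. -/
noncomputable def fejer (d : ℕ) (θ : ℝ) : ℝ :=
  Complex.normSq (∑ a ∈ range d, Complex.exp (a * θ * Complex.I))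

theorem fejer_eq_sum (d : ℕ) (θ : ℝ) :
    (fejer d θ : ℂ) =
      ∑ a ∈ range d, ∑ b ∈ range d, Complex.exp (((a - b : ℤ) : ℂ) * θ * Complex.I) := by
  rw [fejer, ← Complex.mul_conj, map_sum, sum_mul_sum]
  refine sum_congr rfl fun a _ => sum_congr rfl fun b _ => ?_
  rw [← Complex.exp_conj, ← Complex.exp_add]
  congr 1
  simp
  ring

theorem sum_range_sub_eq_zero (d e : ℕ) :
    ∑ a ∈ range d, ∑ b ∈ range d, (if (a : ℤ) - b + e = 0 then (1 : ℂ) else 0) = (d - e : ℕ) := by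
  have h1 : ∀ a ∈ range d, ∑ b ∈ range d, (if (a : ℤ) - b + e = 0 then (1 : ℂ) else 0) =
      if a < d - e then 1 else 0 := fun a _ => by
    have : ∀ b : ℕ, ((a : ℤ) - b + e = 0) ↔ a + e = b := fun b => by lia
    simp only [this, sum_ite_eq, mem_range]
    congr 1
    simp only [eq_iff_iff]
    lia
  rw [sum_congr rfl h1, sum_boole]
  congr 1
  rw [show filter (fun a => a < d - e) (range d) = range (d - e) by ext; simp; lia, card_range]

/-- The average of the Fejér kernel against a character. -/
theorem sum_fejer_mul_cexp {d : ℕ} {n : ℤ} (hd : 0 < d) (hn : |n| ≤ 2 * d) :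
    ∑ j ∈ range (4 * d), (fejer d (2 * Real.pi * j / (4 * d : ℕ)) : ℂ) *
        Complex.exp (n * ((2 * Real.pi * j / (4 * d : ℕ) : ℝ) : ℂ) * Complex.I) =
      (4 * d : ℕ) * ((d - n.natAbs : ℕ) : ℂ) := by
  simp only [fejer_eq_sum, sum_mul, ← Complex.exp_add, ← add_mul, ← Int.cast_add]
  rw [sum_comm]
  simp only [sum_comm (s := range (4 * d))]
  have h1 : ∀ a ∈ range d, ∀ b ∈ range d, ∑ j ∈ range (4 * d), Complex.exp
      (((a - b + n : ℤ) : ℂ) * ((2 * Real.pi * j / (4 * d : ℕ) : ℝ) : ℂ) * Complex.I) =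
        (4 * d : ℕ) * (if (a : ℤ) - b + n = 0 then 1 else 0) := fun a ha b hb => by
    rw [mem_range] at ha hb
    -- The frequencies a - b + n are at most 3d - 1 in absolute value, so 4d nodes produce no
    -- aliasing.
    rw [sum_cexp_equidistributed (by rw [abs_lt]; rw [abs_le] at hn; push_cast; lia), mul_ite, mul_one,
      mul_zero]
  rw [sum_congr rfl fun a ha => sum_congr rfl fun b hb => h1 a ha b hb]
  simp only [← mul_sum]
  congr 1
  rcases Int.natAbs_eq n with h | h
  · rw [← sum_range_sub_eq_zero]
    simp [← h]
  · rw [← sum_range_sub_eq_zero, sum_comm]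
    refine sum_congr rfl fun a _ => sum_congr rfl fun b _ => ?_
    congr 1
    simp only [eq_iff_iff]
    lia

/-- The weights of the quadrature formula for the derivative at `0`. -/
noncomputable def bernsteinWeight (d j : ℕ) : ℝ :=
  2 * Real.sin (d * (2 * Real.pi * j / (4 * d : ℕ))) *
    fejer d (2 * Real.pi * j / (4 * d : ℕ)) / (4 * d : ℕ)

/-- The sine shifts the frequency by ±d, so the sum is a difference of two Fejér coefficients. With
truncated subtraction, (d - |n-d|) - (d - |n+d|) = n for |n| ≤ d. -/
theorem sum_bernsteinWeight_mul_cexp {d : ℕ} {n : ℤ} (hd : 0 < d) (hn : |n| ≤ d) :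
    ∑ j ∈ range (4 * d), (bernsteinWeight d j : ℂ) *
        Complex.exp (n * ((2 * Real.pi * j / (4 * d : ℕ) : ℝ) : ℂ) * Complex.I) =
      Complex.I * n := by
  have hN : ((4 * d : ℕ) : ℂ) ≠ 0 := by exact_mod_cast (by lia : 4 * d ≠ 0)
  have h1 : ∀ j ∈ range (4 * d), (bernsteinWeight d j : ℂ) *
        Complex.exp (n * ((2 * Real.pi * j / (4 * d : ℕ) : ℝ) : ℂ) * Complex.I) =
      Complex.I / (4 * d : ℕ) * ((fejer d (2 * Real.pi * j / (4 * d : ℕ)) : ℂ) *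
        Complex.exp ((n - d : ℤ) * ((2 * Real.pi * j / (4 * d : ℕ) : ℝ) : ℂ) * Complex.I) -
        (fejer d (2 * Real.pi * j / (4 * d : ℕ)) : ℂ) *
        Complex.exp ((n + d : ℤ) * ((2 * Real.pi * j / (4 * d : ℕ) : ℝ) : ℂ) * Complex.I)) :=
    fun j _ => by
      rw [bernsteinWeight]
      generalize (2 * Real.pi * j / (4 * d : ℕ) : ℝ) = θ
      rw [show (((n - d : ℤ) : ℂ) * (θ : ℂ) * Complex.I) =
          n * θ * Complex.I + -((d : ℂ) * θ) * Complex.I by push_cast; ring,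
        show (((n + d : ℤ) : ℂ) * (θ : ℂ) * Complex.I) =
          n * θ * Complex.I + ((d : ℂ) * θ) * Complex.I by push_cast; ring,
        Complex.exp_add, Complex.exp_add, Complex.ofReal_div, Complex.ofReal_mul,
        Complex.ofReal_mul, Complex.ofReal_sin, Complex.sin]
      push_cast
      field_simp
  rw [sum_congr rfl h1, ← mul_sum, sum_sub_distrib, sum_fejer_mul_cexp hd, sum_fejer_mul_cexp hd]
  · rw [abs_le] at hn
    have h2 : (((d - (n - d).natAbs : ℕ) : ℤ) - ((d - (n + d).natAbs : ℕ) : ℤ)) = n := by lia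
    have h3 : (((d - (n - d).natAbs : ℕ) : ℂ) - ((d - (n + d).natAbs : ℕ) : ℂ)) = n := by
      exact_mod_cast congrArg (Int.cast : ℤ → ℂ) h2
    rw [← mul_sub, h3]
    field_simp
  · rw [abs_le] at hn ⊢; lia
  · rw [abs_le] at hn ⊢; lia

/-- The right side is the derivative at 0 of exp(inθ) sin(θ)^k. Each sine is a difference of
exponentials, so the induction on k shifts n by ±1; only n = 0 is used later. -/
theorem sum_bernsteinWeight_mul_cexp_mul_sin_pow {d : ℕ} (hd : 0 < d) (k : ℕ) (n : ℤ)
    (hn : |n| + k ≤ d) :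
    ∑ j ∈ range (4 * d), (bernsteinWeight d j : ℂ) *
        (Complex.exp (n * ((2 * Real.pi * j / (4 * d : ℕ) : ℝ) : ℂ) * Complex.I) *
          Complex.sin ((2 * Real.pi * j / (4 * d : ℕ) : ℝ) : ℂ) ^ k) =
      if k = 0 then Complex.I * n else if k = 1 then 1 else 0 := by
  induction k generalizing n with
  | zero => simpa using sum_bernsteinWeight_mul_cexp hd (by simpa using hn)
  | succ k ih =>
    push_cast at hn
    have h1 := ih (n + 1) (by have := abs_add_le n 1; simp at this; lia)
    have h2 := ih (n - 1) (by have := abs_sub n 1; simp at this; lia)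
    have h3 : ∀ j ∈ range (4 * d), (bernsteinWeight d j : ℂ) *
        (Complex.exp (n * ((2 * Real.pi * j / (4 * d : ℕ) : ℝ) : ℂ) * Complex.I) *
          Complex.sin ((2 * Real.pi * j / (4 * d : ℕ) : ℝ) : ℂ) ^ (k + 1)) =
        -Complex.I / 2 * ((bernsteinWeight d j : ℂ) *
        (Complex.exp ((n + 1 : ℤ) * ((2 * Real.pi * j / (4 * d : ℕ) : ℝ) : ℂ) * Complex.I) *
          Complex.sin ((2 * Real.pi * j / (4 * d : ℕ) : ℝ) : ℂ) ^ k) -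
          (bernsteinWeight d j : ℂ) *
        (Complex.exp ((n - 1 : ℤ) * ((2 * Real.pi * j / (4 * d : ℕ) : ℝ) : ℂ) * Complex.I) *
          Complex.sin ((2 * Real.pi * j / (4 * d : ℕ) : ℝ) : ℂ) ^ k)) := fun j _ => by
      generalize (2 * Real.pi * j / (4 * d : ℕ) : ℝ) = θ
      rw [show (((n + 1 : ℤ) : ℂ) * (θ : ℂ) * Complex.I) =
          n * θ * Complex.I + θ * Complex.I by push_cast; ring,
        show (((n - 1 : ℤ) : ℂ) * (θ : ℂ) * Complex.I) =
          n * θ * Complex.I + -θ * Complex.I by push_cast; ring,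
        Complex.exp_add, Complex.exp_add, pow_succ]
      have : Complex.sin (θ : ℂ) = (Complex.exp (-θ * Complex.I) - Complex.exp (θ * Complex.I)) *
        Complex.I / 2 := rfl
      nth_rw 2 [this]
      ring
    rw [sum_congr rfl h3, ← mul_sum, sum_sub_distrib, h1, h2]
    rcases k with _ | _ | k
    · simp
      linear_combination (-1 : ℂ) * Complex.I_mul_I
    · simp
    · simp

theorem sum_abs_bernsteinWeight_le {d : ℕ} (hd : 0 < d) :
    ∑ j ∈ range (4 * d), |bernsteinWeight d j| ≤ 2 * d := by
  have h0 := sum_fejer_mul_cexp (n := 0) hd (by simp)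
  simp only [Int.cast_zero, zero_mul, Complex.exp_zero, mul_one, Int.natAbs_zero, tsub_zero] at h0
  have h1 : ∑ j ∈ range (4 * d), fejer d (2 * Real.pi * j / (4 * d : ℕ)) = (4 * d : ℕ) * d := by
    exact_mod_cast h0
  have hN : (0 : ℝ) < (4 * d : ℕ) := by exact_mod_cast (by lia : 0 < 4 * d)
  calc ∑ j ∈ range (4 * d), |bernsteinWeight d j|
      ≤ ∑ j ∈ range (4 * d), 2 * fejer d (2 * Real.pi * j / (4 * d : ℕ)) / (4 * d : ℕ) := by
        refine sum_le_sum fun j _ => ?_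
        have hf : 0 ≤ fejer d (2 * Real.pi * j / (4 * d : ℕ)) := Complex.normSq_nonneg _
        rw [bernsteinWeight, abs_div, abs_of_pos hN, abs_mul, abs_of_nonneg hf, abs_mul,
          abs_of_pos (two_pos : (0 : ℝ) < 2)]
        gcongr
        exact mul_le_of_le_one_right two_pos.le (Real.abs_sin_le_one _)
    _ = 2 * d := by
        rw [← sum_div, ← mul_sum, h1]
        field_simp

/-- A discrete Bernstein inequality: the derivative at `0` of a polynomial of degree at most `d`
is controlled by its values at `4 * d` points of `[-1/2, 1/2]`. -/
theorem exists_bernstein_nodes {d : ℕ} (hd : 0 < d) :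
    ∃ x : ℕ → ℝ, (∀ j, |x j| ≤ 1 / 2) ∧ ∀ (p : Polynomial ℝ), p.natDegree ≤ d → ∀ t : ℝ, 0 < t →
      8 * d * t ≤ |p.derivative.eval 0| → ∃ j ∈ range (4 * d), t ≤ |p.eval (x j)| := by
  -- p(sin θ / 2) is a trigonometric polynomial of degree at most d with derivative p'(0)/2 at 0.
  -- Halving keeps the nodes away from ±1, where the correlated signs would degenerate.
  refine ⟨fun j => Real.sin (2 * Real.pi * j / (4 * d : ℕ)) / 2, fun j => ?_, ?_⟩
  · rw [abs_div, abs_of_pos (two_pos : (0 : ℝ) < 2)]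
    linarith [Real.abs_sin_le_one (2 * Real.pi * j / (4 * d : ℕ))]
  intro p hp t ht h
  by_contra! hlt
  have hpow : ∀ k ≤ d, ∑ j ∈ range (4 * d), bernsteinWeight d j *
      Real.sin (2 * Real.pi * j / (4 * d : ℕ)) ^ k = if k = 1 then 1 else 0 := fun k hk => by
    have h1 := sum_bernsteinWeight_mul_cexp_mul_sin_pow hd k 0 (by simpa using hk)
    simp only [Int.cast_zero, zero_mul, Complex.exp_zero, one_mul, mul_zero] at h1
    have h2 : (if k = 0 then (0 : ℂ) else if k = 1 then 1 else 0) =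
        ((if k = 1 then 1 else 0 : ℝ) : ℂ) := by
      split_ifs <;> simp_all
    rw [h2] at h1
    exact_mod_cast h1
  have hquad : ∑ j ∈ range (4 * d), bernsteinWeight d j *
      p.eval (Real.sin (2 * Real.pi * j / (4 * d : ℕ)) / 2) = p.derivative.eval 0 / 2 := by
    simp only [Polynomial.eval_eq_sum_range' (Nat.lt_succ_of_le hp), mul_sum]
    rw [sum_comm]
    have h1 : ∀ k ∈ range d.succ, ∑ j ∈ range (4 * d), bernsteinWeight d j *
        (p.coeff k * (Real.sin (2 * Real.pi * j / (4 * d : ℕ)) / 2) ^ k) =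
        if k = 1 then p.coeff 1 / 2 else 0 := fun k hk => by
      have h2 := hpow k (Nat.lt_succ_iff.1 (mem_range.1 hk))
      calc _ = p.coeff k / 2 ^ k * ∑ j ∈ range (4 * d), bernsteinWeight d j *
            Real.sin (2 * Real.pi * j / (4 * d : ℕ)) ^ k := by
            rw [mul_sum]
            exact sum_congr rfl fun j _ => by rw [div_pow]; ring
        _ = _ := by
            rw [h2]
            split_ifs with hk1
            · subst hk1; simp
            · simp
    rw [sum_congr rfl h1, sum_ite_eq' (range d.succ) 1 (fun _ => p.coeff 1 / 2),
      if_pos (mem_range.2 (by lia)), ← Polynomial.coeff_zero_eq_eval_zero,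
      Polynomial.coeff_derivative]
    simp
  -- This yields |p'(0)| ≤ 4dt; the constant 8 in the hypothesis leaves room for a strict
  -- contradiction.
  have h1 : |p.derivative.eval 0| / 2 ≤ 2 * d * t := by
    rw [← abs_of_pos (two_pos : (0 : ℝ) < 2), ← abs_div, ← hquad,
      abs_of_pos (two_pos : (0 : ℝ) < 2)]
    refine (abs_sum_le_sum_abs _ _).trans ?_
    calc _ ≤ ∑ j ∈ range (4 * d), |bernsteinWeight d j| * t := by
          refine sum_le_sum fun j hj => ?_
          rw [abs_mul]
          gcongr
          exact (hlt j hj).le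
      _ = (∑ j ∈ range (4 * d), |bernsteinWeight d j|) * t := by rw [sum_mul]
      _ ≤ _ := by gcongr; exact sum_abs_bernsteinWeight_le hd
  have hd' : (0 : ℝ) < d := by exact_mod_cast hd
  nlinarith [mul_pos hd' ht]

end Bernstein

/-! ### Correlated signs: passing from the linear part to the whole function. -/

section Noise

/-- The law of a `ρ`-correlated copy of the sign `s`. -/
noncomputable def noise (ρ : ℝ) (s τ : Bool) : ℝ := (1 + ρ * boolSign s * boolSign τ) / 2

theorem isProbWeight_noise {ρ : ℝ} (hρ : |ρ| ≤ 1 / 2) (s : Bool) : IsProbWeight (noise ρ s) where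
  nonneg τ := by
    rw [abs_le] at hρ
    cases s <;> cases τ <;> simp [noise] <;> linarith
  sum_eq_one := by cases s <;> simp [noise] <;> ring

variable {ι : Type*} [Fintype ι] [DecidableEq ι]

theorem wMean_coin_noise (ρ : ℝ) (H : (ι → Bool) → ℝ) :
    wMean (prodWeight fun _ : ι => coin)
        (fun σ => wMean (prodWeight fun i => noise ρ (σ i)) H) =
      wMean (prodWeight fun _ : ι => coin) H := by
  simp only [wMean, mul_sum, ← mul_assoc]
  rw [sum_comm]
  refine sum_congr rfl fun τ _ => ?_
  rw [← sum_mul]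
  congr 1
  simp only [prodWeight, ← prod_mul_distrib]
  rw [sum_prod_apply (fun i s => coin s * noise ρ s (τ i))]
  refine prod_congr rfl fun i _ => ?_
  simp [coin, noise]
  ring

theorem wMean_noise_affine (ρ u v : ℝ) (s : Bool) :
    wMean (noise ρ s) (fun τ => u + boolSign τ * v) = u + ρ * (boolSign s * v) := by
  cases s <;> simp [wMean, noise] <;> ring

/-- Uniform hypercontractivity for biased signs: the ratio is (1 + 3ρ²)/(1 - ρ²), at most 3 once ρ²
≤ 1/3. It leads to the base 48 = 16·3 below. -/
theorem noise_fourth_moment_le {ρ : ℝ} (hρ : |ρ| ≤ 1 / 2) (u v : ℝ) (s : Bool) :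
    wMean (noise ρ s) (fun r => (u + boolSign r * v -
        wMean (noise ρ s) (fun τ => u + boolSign τ * v)) ^ 4) ≤
      3 * wMean (noise ρ s) (fun r => (u + boolSign r * v -
        wMean (noise ρ s) (fun τ => u + boolSign τ * v)) ^ 2) ^ 2 := by
  have hm : ρ ^ 2 ≤ 1 / 4 := by nlinarith [sq_abs ρ, abs_nonneg ρ]
  have h4 : wMean (noise ρ s) (fun r => (u + boolSign r * v -
        wMean (noise ρ s) (fun τ => u + boolSign τ * v)) ^ 4) =
      v ^ 4 * ((1 - ρ ^ 2) * (1 + 3 * ρ ^ 2)) := by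
    simp only [wMean_noise_affine]
    cases s <;> simp [wMean, noise] <;> ring
  have h2 : wMean (noise ρ s) (fun r => (u + boolSign r * v -
        wMean (noise ρ s) (fun τ => u + boolSign τ * v)) ^ 2) = v ^ 2 * (1 - ρ ^ 2) := by
    simp only [wMean_noise_affine]
    cases s <;> simp [wMean, noise] <;> ring
  rw [h4, h2]
  have h1 : (1 - ρ ^ 2) * (1 + 3 * ρ ^ 2) ≤ (1 - ρ ^ 2) * (3 * (1 - ρ ^ 2)) :=
    mul_le_mul_of_nonneg_left (by linarith) (by linarith)
  calc v ^ 4 * ((1 - ρ ^ 2) * (1 + 3 * ρ ^ 2)) ≤ v ^ 4 * ((1 - ρ ^ 2) * (3 * (1 - ρ ^ 2))) := by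
        gcongr
    _ = _ := by ring

/-- The partial derivative in direction `i` of a multi-affine function. -/
noncomputable def partialDeriv (c : Finset ι → ℝ) (i : ι) (u : ι → ℝ) : ℝ :=
  ∑ S with i ∈ S, c S * ∏ l ∈ S.erase i, u l

open Polynomial in
theorem exists_line_polynomial (c : Finset ι → ℝ) {d : ℕ} (hc : ∀ S, d < #S → c S = 0)
    (u v : ι → ℝ) :
    ∃ p : ℝ[X], p.natDegree ≤ d ∧
      (∀ ρ, p.eval ρ = multiAffine c univ (fun i => u i + v i * ρ)) ∧
      p.derivative.eval 0 = ∑ i, v i * partialDeriv c i u := by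
  refine ⟨∑ S, C (c S) * ∏ i ∈ S, (C (u i) + C (v i) * X), ?_, fun ρ => ?_, ?_⟩
  · refine natDegree_sum_le_of_forall_le _ _ fun S _ => ?_
    by_cases hS : d < #S
    · simp [hc S hS]
    · refine natDegree_C_mul_le _ _ |>.trans <| (natDegree_prod_le _ _).trans ?_
      refine (sum_le_card_nsmul _ _ 1 fun i _ => ?_).trans (by simpa using not_lt.1 hS)
      compute_degree
  · simp [multiAffine, eval_finsetSum, eval_prod]
  · simp only [derivative_sum, derivative_C_mul, derivative_prod_finset, eval_finsetSum, eval_mul,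
      eval_C, eval_prod, mul_sum, partialDeriv]
    simp only [derivative_add, derivative_C, derivative_mul, derivative_X, eval_add, eval_C,
      eval_mul, eval_X, eval_one, zero_mul, add_zero, zero_add, mul_zero,
      sum_filter]
    rw [sum_comm' (s := univ) (t := fun S => S) (t' := univ)
      (s' := fun i => univ.filter fun S => i ∈ S) (by simp)]
    refine sum_congr rfl fun i _ => ?_
    rw [sum_filter]
    refine sum_congr rfl fun S _ => ?_
    split_ifs <;> ring

/-- A lower bound on the tail of a multi-affine function of independent signs, in terms of its
linear part. -/
theorem wProb_signs_ge (c : Finset ι → ℝ) {d : ℕ} (hd : 0 < d) (hc : ∀ S, d < #S → c S = 0)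
    (u v : ι → ℝ) {t : ℝ} (ht : 0 < t) :
    wProb (prodWeight fun _ : ι => coin)
        {σ | 8 * d * t ≤ |∑ i, (v i * partialDeriv c i u) * boolSign (σ i)|} /
        (16 * d * 48 ^ d) ≤
      wProb (prodWeight fun _ : ι => coin)
        {τ | t ≤ |multiAffine c univ (fun i => u i + boolSign (τ i) * v i)|} := by
  have hW := isProbWeight_prodWeight (fun _ : ι => isProbWeight_coin)
  obtain ⟨x, hx, hnodes⟩ := exists_bernstein_nodes hd
  set E : Set (ι → Bool) := {τ | t ≤ |multiAffine c univ (fun i => u i + boolSign (τ i) * v i)|}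
  set P : ℕ → (ι → Bool) → ℝ := fun j σ => wProb (prodWeight fun i => noise (x j) (σ i)) E
  have hP0 : ∀ j σ, 0 ≤ P j σ := fun j σ =>
    (isProbWeight_prodWeight fun i => isProbWeight_noise (hx j) (σ i)).wProb_nonneg _
  -- The good node depends on σ, so all 4d nodes are summed; each contributes the same mean because
  -- the noise preserves the uniform law.
  have h1 := hW.mul_wProb_le_wMean
    (s := {σ | 8 * d * t ≤ |∑ i, (v i * partialDeriv c i u) * boolSign (σ i)|})
    (a := 1 / (4 * 48 ^ d)) (F := fun σ => ∑ j ∈ range (4 * d), P j σ)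
    (fun σ => sum_nonneg fun j _ => hP0 j σ) (fun σ hσ => by
      obtain ⟨p, hp, hpe, hpd⟩ := exists_line_polynomial c hc u (fun i => boolSign (σ i) * v i)
      obtain ⟨j, hj, hjt⟩ := hnodes p hp t ht (by
        rw [hpd]
        refine (show _ ≤ _ from hσ).trans_eq ?_
        congr 1
        exact sum_congr rfl fun i _ => by ring)
      refine le_trans ?_ (single_le_sum (fun j _ => hP0 j σ) hj)
      have hn := fun i => isProbWeight_noise (hx j) (σ i)
      have := wProb_multiAffine_abs_ge hn (B := 3) (Z := fun i τ => u i + boolSign τ * v i)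
        (by norm_num) (fun i => noise_fourth_moment_le (hx j) _ _ _) univ d c
        (fun S _ => hc S) (t := t) (by
          rw [wMean_multiAffine hn (fun i τ => u i + boolSign τ * v i)]
          simp only [wMean_noise_affine]
          simpa only [hpe, mul_comm (x j)] using hjt)
      norm_num only at this ⊢
      exact this)
  have h2 : wMean (prodWeight fun _ : ι => coin) (fun σ => ∑ j ∈ range (4 * d), P j σ) =
      4 * d * wProb (prodWeight fun _ : ι => coin) E := by
    rw [wMean_sum]
    simp only [P, wProb, wMean_coin_noise, sum_const, card_range, nsmul_eq_mul]
    push_cast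
    ring
  rw [h2] at h1
  have hd' : (0 : ℝ) < d := by exact_mod_cast hd
  rw [div_le_iff₀ (by positivity)]
  rw [one_div_mul_eq_div, div_le_iff₀ (by positivity)] at h1
  linarith

end Noise

/-! ### Size and truncation of the random linear coefficients. -/

section Averaging

variable {ι : Type*} [Fintype ι] [DecidableEq ι]

/-- The influence of `i` on the multi-affine function with coefficients `c`. -/
noncomputable def infl (c : Finset ι → ℝ) (i : ι) : ℝ := ∑ S with i ∈ S, c S ^ 2

/-- The mass of the coefficients `c` on the sets not contained in `J`. -/
noncomputable def massOutside (c : Finset ι → ℝ) (J : Finset ι) : ℝ :=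
  ∑ S with (S \ J).Nonempty, c S ^ 2

theorem infl_nonneg (c : Finset ι → ℝ) (i : ι) : 0 ≤ infl c i :=
  sum_nonneg fun _ _ => sq_nonneg _

theorem sum_infl_le (c : Finset ι → ℝ) {d : ℕ} (hc : ∀ S, d < #S → c S = 0) (J : Finset ι) :
    ∑ i ∈ Jᶜ, infl c i ≤ d * massOutside c J := by
  simp only [infl, massOutside, mul_sum]
  rw [sum_comm' (s := Jᶜ) (t := fun i => univ.filter fun S => i ∈ S)
    (t' := univ.filter fun S => (S \ J).Nonempty) (s' := fun S => S \ J)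
    (fun i S => by
      simp only [mem_compl, mem_filter, mem_univ, true_and, mem_sdiff]
      exact ⟨fun h => ⟨⟨h.2, h.1⟩, ⟨i, mem_sdiff.2 ⟨h.2, h.1⟩⟩⟩, fun h => ⟨h.1.2, h.1.1⟩⟩)]
  refine sum_le_sum fun S _ => ?_
  rw [sum_const, nsmul_eq_mul]
  by_cases hS : d < #S
  · simp [hc S hS]
  · gcongr
    exact (card_le_card sdiff_subset).trans (not_lt.1 hS)

theorem sum_powerset_erase (i : ι) (g : Finset ι → ℝ) :
    ∑ S ∈ (univ.erase i).powerset, g (insert i S) = ∑ S with i ∈ S, g S := by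
  refine sum_nbij' (fun S => insert i S) (fun S => S.erase i) ?_ ?_ ?_ ?_ ?_
  · simp
  · intro S _
    exact mem_powerset.2 (erase_subset_erase i (subset_univ S))
  · intro S hS
    exact erase_insert fun h => by simpa using mem_powerset.1 hS h
  · intro S hS
    exact insert_erase (by simpa using hS)
  · simp

theorem partialDeriv_eq_multiAffine (c : Finset ι → ℝ) (i : ι) (u : ι → ℝ) :
    partialDeriv c i u = multiAffine (fun S => c (insert i S)) (univ.erase i) u := by
  rw [partialDeriv, ← sum_powerset_erase]
  refine sum_congr rfl fun S hS => ?_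
  rw [erase_insert fun h => by simpa using mem_powerset.1 hS h]

theorem partialDeriv_update {R : Type*} (c : Finset ι → ℝ) (i : ι) (u : ι → R → ℝ) (ω : ι → R) (r : R) :
    partialDeriv c i (fun l => u l (Function.update ω i r l)) =
      partialDeriv c i (fun l => u l (ω l)) := by
  simp only [partialDeriv_eq_multiAffine]
  exact multiAffine_update _ (by simp) u ω r

variable {R : Type*} [Fintype R]

theorem wMean_partialDeriv_sq {w : ι → R → ℝ} (hw : ∀ i, IsProbWeight (w i)) {u : ι → R → ℝ}
    (hu : ∀ i, wMean (w i) (u i) = 0) (c : Finset ι → ℝ) (i : ι) :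
    wMean (prodWeight w) (fun ω => partialDeriv c i (fun l => u l (ω l)) ^ 2) =
      ∑ S with i ∈ S, c S ^ 2 * ∏ l ∈ S.erase i, wMean (w l) (fun r => u l r ^ 2) := by
  simp only [partialDeriv_eq_multiAffine]
  rw [wMean_multiAffine_sq hw hu, ← sum_powerset_erase]
  refine sum_congr rfl fun S hS => ?_
  rw [erase_insert fun h => by simpa using mem_powerset.1 hS h]

theorem wMean_partialDeriv_sq_le {w : ι → R → ℝ} (hw : ∀ i, IsProbWeight (w i))
    {u : ι → R → ℝ} (hu : ∀ i, wMean (w i) (u i) = 0)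
    (hu2 : ∀ i, wMean (w i) (fun r => u i r ^ 2) ≤ 1) (c : Finset ι → ℝ) (i : ι) :
    wMean (prodWeight w) (fun ω => partialDeriv c i (fun l => u l (ω l)) ^ 2) ≤ infl c i := by
  rw [wMean_partialDeriv_sq hw hu]
  exact sum_le_sum fun S _ => mul_le_of_le_one_right (sq_nonneg _)
    (prod_le_one (fun l _ => (hw l).wMean_nonneg fun r => sq_nonneg _) fun l _ => hu2 l)

theorem wMean_mul_partialDeriv_pow {w : ι → R → ℝ} (hw : ∀ i, IsProbWeight (w i))
    (u v : ι → R → ℝ) (c : Finset ι → ℝ) (i : ι) (k : ℕ) :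
    wMean (prodWeight w) (fun ω => (v i (ω i) * partialDeriv c i (fun l => u l (ω l))) ^ k) =
      wMean (prodWeight w) (fun ω => partialDeriv c i (fun l => u l (ω l)) ^ k) *
        wMean (w i) (fun r => v i r ^ k) := by
  rw [← wMean_prodWeight_mul hw i (fun ω r => by rw [partialDeriv_update])]
  congr 1
  funext ω
  rw [mul_pow, mul_comm]

/-- The derivative in direction i does not involve coordinate i, so the moment factors. As second
moments are only at least 1/2, the kurtosis bound is 4B, whence 64B = 16·4B. -/
theorem wMean_mul_partialDeriv_pow_four_le {w : ι → R → ℝ} (hw : ∀ i, IsProbWeight (w i))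
    {u v : ι → R → ℝ} {B : ℝ} (hB : 1 ≤ B) (hu : ∀ i, wMean (w i) (u i) = 0)
    (hu2 : ∀ i, wMean (w i) (fun r => u i r ^ 2) ≤ 1)
    (hu2' : ∀ i, 1 / 2 ≤ wMean (w i) (fun r => u i r ^ 2))
    (hu4 : ∀ i, wMean (w i) (fun r => u i r ^ 4) ≤ B)
    (hv4 : ∀ i, wMean (w i) (fun r => v i r ^ 4) ≤ B)
    (c : Finset ι → ℝ) {d : ℕ} (hc : ∀ S, d < #S → c S = 0) (i : ι) :
    wMean (prodWeight w) (fun ω => (v i (ω i) * partialDeriv c i (fun l => u l (ω l))) ^ 4) ≤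
      B * (64 * B) ^ d * infl c i ^ 2 := by
  have hW := isProbWeight_prodWeight hw
  have h2 := wMean_partialDeriv_sq_le hw hu hu2 c i
  have h4 : wMean (prodWeight w) (fun ω => partialDeriv c i (fun l => u l (ω l)) ^ 4) ≤
      (64 * B) ^ d *
        wMean (prodWeight w) (fun ω => partialDeriv c i (fun l => u l (ω l)) ^ 2) ^ 2 := by
    simp only [partialDeriv_eq_multiAffine]
    have := wMean_multiAffine_pow_four_le hw (Z := u) (B := 4 * B) (by linarith)
      (fun l => by
        simp only [hu, sub_zero]
        have := hu2' l
        refine (hu4 l).trans ?_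
        have h1 : (1 / 2) ^ 2 ≤ wMean (w l) (fun r => u l r ^ 2) ^ 2 := by gcongr
        nlinarith) (univ.erase i) d (fun S => c (insert i S))
        (fun S _ hS => hc _ (hS.trans_le (card_le_card (subset_insert i S))))
    rwa [show 16 * (4 * B) = 64 * B by ring] at this
  have hn : 0 ≤ wMean (prodWeight w) (fun ω => partialDeriv c i (fun l => u l (ω l)) ^ 2) :=
    hW.wMean_nonneg fun ω => sq_nonneg _
  have hn4 : 0 ≤ wMean (w i) (fun r => v i r ^ 4) := (hw i).wMean_nonneg fun r => by positivity
  rw [wMean_mul_partialDeriv_pow hw]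
  calc _ ≤ ((64 * B) ^ d * infl c i ^ 2) * B := by
        gcongr
        · exact h4.trans (by gcongr)
        · exact hv4 i
    _ = _ := by ring

/-- With probability bounded from below, the coefficients of the linear part have large
truncated square sum. -/
theorem wProb_truncated_sum_ge {w : ι → R → ℝ} (hw : ∀ i, IsProbWeight (w i))
    {u v : ι → R → ℝ} {B : ℝ} (hB : 1 ≤ B) (hu : ∀ i, wMean (w i) (u i) = 0)
    (hu2 : ∀ i, wMean (w i) (fun r => u i r ^ 2) ≤ 1)
    (hu2' : ∀ i, 1 / 2 ≤ wMean (w i) (fun r => u i r ^ 2))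
    (hu4 : ∀ i, wMean (w i) (fun r => u i r ^ 4) ≤ B)
    (hv4 : ∀ i, wMean (w i) (fun r => v i r ^ 4) ≤ B)
    (c : Finset ι → ℝ) {d : ℕ} (hd : 0 < d) (hc : ∀ S, d < #S → c S = 0) (J : Finset ι)
    {η θ q M : ℝ} (hM : 0 < M)
    (hmass : massOutside c J ≤ M) (hη : ∀ i ∉ J, infl c i ≤ η) (hη0 : 0 ≤ η)
    (hθ : 0 < θ) (hq : 0 < q) (hθq : B * (64 * B) ^ d * η * (d * M) ≤ θ * (q / 2))
    (hQ : q ≤ wMean (prodWeight w) (fun ω =>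
      ∑ i ∈ Jᶜ, (v i (ω i) * partialDeriv c i (fun l => u l (ω l))) ^ 2)) :
    (q / 2) ^ 2 / (4 * (B * (64 * B) ^ d * (d * M) ^ 2)) ≤
      wProb (prodWeight w) {ω | q / 4 ≤ ∑ i ∈ Jᶜ with
        (v i (ω i) * partialDeriv c i (fun l => u l (ω l))) ^ 2 ≤ θ,
          (v i (ω i) * partialDeriv c i (fun l => u l (ω l))) ^ 2} := by
  have hW := isProbWeight_prodWeight hw
  set a : ι → (ι → R) → ℝ := fun i ω => v i (ω i) * partialDeriv c i (fun l => u l (ω l)) with ha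
  set K := B * (64 * B) ^ d with hK
  have hK0 : 0 < K := by positivity
  have h4 : ∀ i, wMean (prodWeight w) (fun ω => a i ω ^ 4) ≤ K * infl c i ^ 2 := fun i =>
    wMean_mul_partialDeriv_pow_four_le hw hB hu hu2 hu2' hu4 hv4 c hc i
  have hI : ∑ i ∈ Jᶜ, infl c i ≤ d * M :=
    (sum_infl_le c hc J).trans (by gcongr)
  have hI0 : 0 ≤ ∑ i ∈ Jᶜ, infl c i := sum_nonneg fun i _ => infl_nonneg c i
  have hd' : (0 : ℝ) < d := by exact_mod_cast hd
  have hfirst : q / 2 ≤ wMean (prodWeight w)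
      (fun ω => ∑ i ∈ Jᶜ with a i ω ^ 2 ≤ θ, a i ω ^ 2) := by
    -- Discarding the terms with a² > θ costs at most a⁴/θ each; small influences make the total of
    -- these fourth moments small.
    have h1 : wMean (prodWeight w) (fun ω => ∑ i ∈ Jᶜ, a i ω ^ 2 - θ⁻¹ * ∑ i ∈ Jᶜ, a i ω ^ 4) ≤
        wMean (prodWeight w) (fun ω => ∑ i ∈ Jᶜ with a i ω ^ 2 ≤ θ, a i ω ^ 2) := by
      refine hW.wMean_mono fun ω => ?_
      rw [mul_sum, ← sum_sub_distrib, sum_filter]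
      refine sum_le_sum fun i _ => ?_
      split_ifs with h
      · exact sub_le_self _ (by positivity)
      · push Not at h
        rw [sub_nonpos, ← div_eq_inv_mul, le_div_iff₀ hθ]
        nlinarith [sq_nonneg (a i ω)]
    rw [wMean_sub, wMean_const_mul, wMean_sum _ Jᶜ
      (fun i ω => a i ω ^ 4)] at h1
    have h2 : ∑ i ∈ Jᶜ, wMean (prodWeight w) (fun ω => a i ω ^ 4) ≤ θ * (q / 2) :=
      calc _ ≤ ∑ i ∈ Jᶜ, K * η * infl c i := sum_le_sum fun i hi => (h4 i).trans (by
            have h3 := mul_le_mul_of_nonneg_right (hη i (mem_compl.1 hi)) (infl_nonneg c i)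
            nlinarith [mul_le_mul_of_nonneg_left h3 hK0.le])
        _ = K * η * ∑ i ∈ Jᶜ, infl c i := by rw [mul_sum]
        _ ≤ K * η * (d * M) := by gcongr
        _ ≤ _ := hθq
    have h3 : θ⁻¹ * ∑ i ∈ Jᶜ, wMean (prodWeight w) (fun ω => a i ω ^ 4) ≤ q / 2 := by
      rw [← div_eq_inv_mul, div_le_iff₀ hθ]
      linarith
    linarith
  have hsecond : wMean (prodWeight w)
      (fun ω => (∑ i ∈ Jᶜ with a i ω ^ 2 ≤ θ, a i ω ^ 2) ^ 2) ≤ K * (d * M) ^ 2 := by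
    have h1 : wMean (prodWeight w) (fun ω => (∑ i ∈ Jᶜ with a i ω ^ 2 ≤ θ, a i ω ^ 2) ^ 2) ≤
        wMean (prodWeight w) (fun ω => ∑ i ∈ Jᶜ, ∑ j ∈ Jᶜ, a i ω ^ 2 * a j ω ^ 2) := by
      refine hW.wMean_mono fun ω => ?_
      rw [← sum_mul_sum, ← sq]
      exact pow_le_pow_left₀ (sum_nonneg fun i _ => sq_nonneg _)
        (sum_le_sum_of_subset_of_nonneg (filter_subset _ _) fun i _ _ => sq_nonneg _) 2
    refine h1.trans ?_
    simp only [wMean_sum]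
    calc _ ≤ ∑ i ∈ Jᶜ, ∑ j ∈ Jᶜ, K * (infl c i * infl c j) := by
          refine sum_le_sum fun i _ => sum_le_sum fun j _ => ?_
          have hi := infl_nonneg c i
          have hj := infl_nonneg c j
          refine le_of_sq_le_sq ?_ (by positivity)
          have cs := hW.wMean_mul_sq_le (fun ω => a i ω ^ 2) (fun ω => a j ω ^ 2)
          simp only [← pow_mul] at cs
          norm_num only at cs
          refine cs.trans ?_
          have n4 : 0 ≤ wMean (prodWeight w) (fun ω => a j ω ^ 4) :=
            hW.wMean_nonneg fun r => by positivity
          calc _ ≤ (K * infl c i ^ 2) * (K * infl c j ^ 2) := by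
                gcongr
                · exact h4 i
                · exact h4 j
            _ = _ := by ring
      _ = K * (∑ i ∈ Jᶜ, infl c i) ^ 2 := by
          simp only [← mul_sum]
          rw [sq, sum_mul_sum]
          simp only [mul_sum]
      _ ≤ _ := by gcongr
  have := hW.paley_zygmund _ (by positivity : (0 : ℝ) ≤ q / 2) (by positivity) hfirst hsecond
  rwa [show q / 2 / 2 = q / 4 by ring] at this

/-- A lower bound on the expected square sum of the coefficients of the linear part. -/
theorem le_wMean_sum_sq {w : ι → R → ℝ} (hw : ∀ i, IsProbWeight (w i))
    {u v : ι → R → ℝ} (hu : ∀ i, wMean (w i) (u i) = 0) (c : Finset ι → ℝ) (J : Finset ι)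
    {k : ℕ} (hk : 0 < k)
    (hu2 : ∀ i, wMean (w i) (fun r => u i r ^ 2) =
      if i ∈ J then (1 : ℝ) else 1 - 1 / (2 * k))
    (hv2 : ∀ i ∉ J, wMean (w i) (fun r => v i r ^ 2) = 1 / (2 * k)) :
    (∑ S with k ≤ #(S \ J) ∧ #(S \ J) < 2 * k, c S ^ 2) / 8 ≤
      wMean (prodWeight w) (fun ω =>
        ∑ i ∈ Jᶜ, (v i (ω i) * partialDeriv c i (fun l => u l (ω l))) ^ 2) := by
  have hk' : (1 : ℝ) ≤ k := by exact_mod_cast hk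
  set x : ℝ := 1 - 1 / (2 * k) with hx
  have hx1 : x ≤ 1 := by rw [hx]; exact sub_le_self _ (by positivity)
  have hx0 : 1 / 2 ≤ x := by
    rw [hx]
    have : 1 / (2 * (k : ℝ)) ≤ 1 / 2 := by
      apply one_div_le_one_div_of_le <;> linarith
    linarith
  -- Bernoulli's inequality gives (1 - 1/(2k))^k ≥ 1/2. So in a set S of the block each of the at
  -- least k coordinates outside J contributes at least c_S²/4 · 1/(2k), in total c_S²/8.
  have hxk : 1 / 4 ≤ x ^ (2 * k) := by
    have h1 := one_add_mul_le_pow (a := -(1 / (2 * (k : ℝ)))) (by linarith) k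
    have h2 : 1 + (k : ℝ) * -(1 / (2 * k)) = 1 / 2 := by field_simp; norm_num
    rw [h2, ← sub_eq_add_neg, ← hx] at h1
    rw [mul_comm, pow_mul]
    nlinarith
  rw [wMean_sum]
  simp only [wMean_mul_partialDeriv_pow hw u v c _ 2, wMean_partialDeriv_sq hw hu, sum_mul]
  rw [sum_comm' (s := Jᶜ) (t := fun i => univ.filter fun S => i ∈ S)
    (t' := univ) (s' := fun S => S \ J) (fun i S => by simp [and_comm]), sum_div]
  have hterm : ∀ S i, 0 ≤ c S ^ 2 * (∏ l ∈ S.erase i, wMean (w l) (fun r => u l r ^ 2)) *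
      wMean (w i) (fun r => v i r ^ 2) := fun S i =>
    mul_nonneg (mul_nonneg (sq_nonneg _) (prod_nonneg fun l _ =>
      (hw l).wMean_nonneg fun r => sq_nonneg _)) ((hw i).wMean_nonneg fun r => sq_nonneg _)
  refine le_trans (sum_le_sum fun S hS => ?_) (sum_le_sum_of_subset_of_nonneg (filter_subset _ _)
    fun S _ _ => sum_nonneg fun i _ => hterm S i)
  obtain ⟨hS1, hS2⟩ := (mem_filter.1 hS).2
  have hprod : ∀ i ∈ S, 1 / 4 ≤ ∏ l ∈ S.erase i, wMean (w l) (fun r => u l r ^ 2) := fun i hi => by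
    have e : ∏ l ∈ S, wMean (w l) (fun r => u l r ^ 2) = x ^ #(S \ J) := by
      simp only [hu2]
      rw [prod_ite, prod_const_one, one_mul, prod_const, ← sdiff_eq_filter]
    have h1 : 1 / 4 ≤ ∏ l ∈ S, wMean (w l) (fun r => u l r ^ 2) := by
      rw [e]
      exact hxk.trans (pow_le_pow_of_le_one (by linarith) hx1 hS2.le)
    rw [← mul_prod_erase S _ hi] at h1
    refine h1.trans (mul_le_of_le_one_left (prod_nonneg fun l _ =>
      (hw l).wMean_nonneg fun r => sq_nonneg _) ?_)
    rw [hu2]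
    split_ifs <;> linarith
  have hc0 := sq_nonneg (c S)
  calc c S ^ 2 / 8 ≤ ∑ i ∈ S \ J, c S ^ 2 * (1 / 4) * (1 / (2 * k)) := by
        rw [sum_const, nsmul_eq_mul]
        have : (k : ℝ) ≤ #(S \ J) := by exact_mod_cast hS1
        calc c S ^ 2 / 8 = k * (c S ^ 2 * (1 / 4) * (1 / (2 * k))) := by
              field_simp; ring
          _ ≤ _ := by gcongr
    _ ≤ _ := sum_le_sum fun i hi => by
        rw [mem_sdiff] at hi
        rw [hv2 i hi.2]
        gcongr
        exact hprod i hi.1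

/-- Some dyadic block of levels carries a logarithmic fraction of the mass outside `J`. -/
theorem exists_dyadic_level (c : Finset ι → ℝ) {d : ℕ} (hc : ∀ S, d < #S → c S = 0)
    (J : Finset ι) :
    ∃ k : ℕ, 0 < k ∧ massOutside c J / (Nat.log 2 d + 1 : ℕ) ≤
      ∑ S with k ≤ #(S \ J) ∧ #(S \ J) < 2 * k, c S ^ 2 := by
  have hsum : massOutside c J ≤ ∑ j ∈ range (Nat.log 2 d + 1),
      ∑ S with 2 ^ j ≤ #(S \ J) ∧ #(S \ J) < 2 * 2 ^ j, c S ^ 2 := by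
    simp only [massOutside, sum_filter]
    rw [sum_comm]
    refine sum_le_sum fun S _ => ?_
    have hn : ∀ j ∈ range (Nat.log 2 d + 1), 0 ≤
        (if 2 ^ j ≤ #(S \ J) ∧ #(S \ J) < 2 * 2 ^ j then c S ^ 2 else 0) := fun j _ => by
      split_ifs <;> positivity
    split_ifs with hS
    · by_cases hd : d < #S
      · simp [hc S hd]
      have hm : #(S \ J) ≠ 0 := (card_pos.2 hS).ne'
      have hle : #(S \ J) ≤ d := (card_le_card sdiff_subset).trans (not_lt.1 hd)
      refine le_trans ?_ (single_le_sum hn (a := Nat.log 2 #(S \ J))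
        (mem_range.2 (Nat.lt_succ_of_le (Nat.log_mono_right hle))))
      rw [if_pos ⟨Nat.pow_log_le_self 2 hm, by
        rw [← pow_succ']; exact Nat.lt_pow_succ_log_self one_lt_two _⟩]
    · exact sum_nonneg hn
  by_contra! hlt
  refine absurd hsum (not_le.2 ?_)
  calc _ < ∑ j ∈ range (Nat.log 2 d + 1), massOutside c J / (Nat.log 2 d + 1 : ℕ) :=
        sum_lt_sum_of_nonempty ⟨0, by simp⟩ fun j _ => hlt (2 ^ j) (by positivity)
    _ = massOutside c J := by
        rw [sum_const, card_range, nsmul_eq_mul]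
        field_simp

end Averaging

/-! ### The random restriction for a general finite law. -/

section Coupling

variable {ι : Type*} [Fintype ι] [DecidableEq ι] {V : Type*} [Fintype V]

theorem wMean_prodWeight_prod_type {R R' : Type*} [Fintype R] [Fintype R'] (w : ι → R → ℝ)
    (w' : ι → R' → ℝ) (F : (ι → R) → (ι → R') → ℝ) :
    wMean (prodWeight w) (fun r => wMean (prodWeight w') (F r)) =
      wMean (prodWeight fun i (x : R × R') => w i x.1 * w' i x.2)
        (fun ω => F (fun i => (ω i).1) (fun i => (ω i).2)) := by
  have : wMean (prodWeight w) (fun r => wMean (prodWeight w') (F r)) =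
      ∑ x : (ι → R) × (ι → R'), prodWeight w x.1 * (prodWeight w' x.2 * F x.1 x.2) := by
    rw [Fintype.sum_prod_type]
    simp only [wMean, mul_sum]
  rw [this]
  refine (Fintype.sum_equiv (Equiv.arrowProdEquivProdArrow ι (fun _ => R) (fun _ => R')) _ _
    fun ω => ?_).symm
  simp [prodWeight, prod_mul_distrib, Equiv.arrowProdEquivProdArrow, mul_assoc]

/-- The law of a pair of independent samples, together with an independent Bernoulli switch. -/
noncomputable def pairWeight (p : V → ℝ) (ε : ℝ) (r : Bool × V × V) : ℝ :=
  (if r.1 then ε else 1 - ε) * (p r.2.1 * p r.2.2)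

/-- Chooses between the two samples if the switch is on, and returns the first one otherwise. -/
def pairSelect (r : Bool × V × V) (τ : Bool) : V :=
  if r.1 then (if τ then r.2.1 else r.2.2) else r.2.1

/-- The midpoint of the two possible values of `pairSelect`. -/
noncomputable def pairMid (X : V → ℝ) (r : Bool × V × V) : ℝ :=
  if r.1 then (X r.2.1 + X r.2.2) / 2 else X r.2.1

/-- Half the difference of the two possible values of `pairSelect`. -/
noncomputable def pairDiff (X : V → ℝ) (r : Bool × V × V) : ℝ :=
  if r.1 then (X r.2.1 - X r.2.2) / 2 else 0

theorem apply_pairSelect {V : Type*} (X : V → ℝ) (r : Bool × V × V) (τ : Bool) :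
    X (pairSelect r τ) = pairMid X r + boolSign τ * pairDiff X r := by
  obtain ⟨b, y, z⟩ := r
  cases b <;> cases τ <;> simp [pairSelect, pairMid, pairDiff] <;> ring

theorem wMean_pairWeight (p : V → ℝ) (ε : ℝ) (F : Bool × V × V → ℝ) :
    wMean (pairWeight p ε) F =
      ε * wMean p (fun y => wMean p fun z => F (true, y, z)) +
        (1 - ε) * wMean p (fun y => wMean p fun z => F (false, y, z)) := by
  simp only [wMean, Fintype.sum_prod_type, Fintype.sum_bool, pairWeight, mul_sum]
  congr 1 <;> refine sum_congr rfl fun y _ => sum_congr rfl fun z _ => ?_ <;> simp <;> ring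

theorem isProbWeight_pairWeight {p : V → ℝ} (hp : IsProbWeight p) {ε : ℝ} (h0 : 0 ≤ ε)
    (h1 : ε ≤ 1) : IsProbWeight (pairWeight p ε) where
  nonneg r := mul_nonneg (by split_ifs <;> linarith) (mul_nonneg (hp.nonneg _) (hp.nonneg _))
  sum_eq_one := by
    have := wMean_pairWeight p ε (fun _ => 1)
    simp only [hp.wMean_const] at this
    simpa [wMean] using this

theorem sum_pairSelect [DecidableEq V] {p : V → ℝ} (hp : IsProbWeight p) (ε : ℝ) (x : V) :
    ∑ r : (Bool × V × V) × Bool with pairSelect r.1 r.2 = x, pairWeight p ε r.1 * coin r.2 =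
      p x := by
  rw [sum_filter]
  simp only [Fintype.sum_prod_type, Fintype.sum_bool, pairWeight, pairSelect, coin]
  simp [sum_add_distrib, ← mul_sum, ← sum_mul, hp.sum_eq_one]
  ring

/-- Sampling through `pairSelect` with random signs reproduces the original law. -/
theorem wMean_pairSelect [DecidableEq V] {p : V → ℝ} (hp : IsProbWeight p) (ε : ι → ℝ)
    (H : (ι → V) → ℝ) :
    wMean (prodWeight fun i => pairWeight p (ε i))
        (fun r => wMean (prodWeight fun _ : ι => coin) fun τ => H fun i => pairSelect (r i) (τ i)) =
      wMean (prodWeight fun _ : ι => p) H := by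
  rw [wMean_prodWeight_prod_type]
  exact wMean_prodWeight_map (fun x : (Bool × V × V) × Bool => pairSelect x.1 x.2)
    (fun i x => sum_pairSelect hp (ε i) x) H

variable {p X : V → ℝ}

theorem wMean_pairMid (hp : IsProbWeight p) (h1 : wMean p X = 0) (ε : ℝ) :
    wMean (pairWeight p ε) (pairMid X) = 0 := by
  rw [wMean_pairWeight]
  simp only [pairMid, if_true, Bool.false_eq_true, if_false, wMean_add,
    hp.wMean_const, div_eq_mul_inv, wMean_mul_const, h1]
  simp

theorem wMean_pairMid_sq (hp : IsProbWeight p) (h1 : wMean p X = 0)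
    (h2 : wMean p (fun x => X x ^ 2) = 1) (ε : ℝ) :
    wMean (pairWeight p ε) (fun r => pairMid X r ^ 2) = 1 - ε / 2 := by
  rw [wMean_pairWeight]
  have e : ∀ y z, ((X y + X z) / 2) ^ 2 = 1 / 4 * X y ^ 2 + (X y / 2 * X z + 1 / 4 * X z ^ 2) :=
    fun y z => by ring
  simp only [pairMid, if_true, Bool.false_eq_true, if_false, e, wMean_add,
    hp.wMean_const, wMean_const_mul, h1, h2, mul_zero]
  ring

theorem wMean_pairDiff_sq (hp : IsProbWeight p) (h1 : wMean p X = 0)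
    (h2 : wMean p (fun x => X x ^ 2) = 1) (ε : ℝ) :
    wMean (pairWeight p ε) (fun r => pairDiff X r ^ 2) = ε / 2 := by
  rw [wMean_pairWeight]
  have e : ∀ y z, ((X y - X z) / 2) ^ 2 =
      1 / 4 * X y ^ 2 + (-X y / 2 * X z + 1 / 4 * X z ^ 2) := fun y z => by ring
  simp only [pairDiff, if_true, Bool.false_eq_true, if_false, e, wMean_add,
    hp.wMean_const, wMean_const_mul, h1, h2, mul_zero]
  ring

theorem wMean_pairMid_pow_four_le (hp : IsProbWeight p) {ε : ℝ} (h0 : 0 ≤ ε) :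
    wMean (pairWeight p ε) (fun r => pairMid X r ^ 4) ≤ wMean p (fun x => X x ^ 4) := by
  rw [wMean_pairWeight]
  have e : ∀ y z, ((X y + X z) / 2) ^ 4 ≤ 1 / 2 * X y ^ 4 + 1 / 2 * X z ^ 4 := fun y z => by
    nlinarith [sq_nonneg (X y - X z), sq_nonneg (X y ^ 2 - X z ^ 2),
      sq_nonneg ((X y - X z) * (X y + X z)), sq_nonneg ((X y - X z) ^ 2)]
  have h : wMean p (fun y => wMean p fun z => pairMid X (true, y, z) ^ 4) ≤
      wMean p (fun x => X x ^ 4) := by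
    refine (hp.wMean_mono fun y => hp.wMean_mono fun z => e y z).trans_eq ?_
    simp only [wMean_add, hp.wMean_const, wMean_const_mul]
    ring
  simp only [pairMid, if_true, Bool.false_eq_true, if_false, hp.wMean_const] at h ⊢
  nlinarith [mul_le_mul_of_nonneg_left h h0]

theorem wMean_pairDiff_pow_four_le (hp : IsProbWeight p) {ε : ℝ} (h0 : 0 ≤ ε) (h1 : ε ≤ 1) :
    wMean (pairWeight p ε) (fun r => pairDiff X r ^ 4) ≤ wMean p (fun x => X x ^ 4) := by
  rw [wMean_pairWeight]
  have e : ∀ y z, ((X y - X z) / 2) ^ 4 ≤ 1 / 2 * X y ^ 4 + 1 / 2 * X z ^ 4 := fun y z => by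
    nlinarith [sq_nonneg (X y + X z), sq_nonneg (X y ^ 2 - X z ^ 2),
      sq_nonneg ((X y - X z) * (X y + X z)), sq_nonneg ((X y + X z) ^ 2)]
  have h : wMean p (fun y => wMean p fun z => pairDiff X (true, y, z) ^ 4) ≤
      wMean p (fun x => X x ^ 4) := by
    refine (hp.wMean_mono fun y => hp.wMean_mono fun z => e y z).trans_eq ?_
    simp only [wMean_add, hp.wMean_const, wMean_const_mul]
    ring
  have h4 : 0 ≤ wMean p (fun x => X x ^ 4) := hp.wMean_nonneg fun x => by positivity
  simp only [pairDiff, if_true, Bool.false_eq_true, if_false, hp.wMean_const] at h ⊢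
  nlinarith [mul_le_mul_of_nonneg_right h1 h4, mul_le_mul_of_nonneg_left h h0]

theorem one_le_fourth_moment (hp : IsProbWeight p) (h2 : wMean p (fun x => X x ^ 2) = 1) :
    1 ≤ wMean p (fun x => X x ^ 4) := by
  have h := hp.wMean_mono (F := fun x => 2 * X x ^ 2 - 1) (G := fun x => X x ^ 4) fun x => by
    nlinarith [sq_nonneg (X x ^ 2 - 1)]
  rw [wMean_sub, wMean_const_mul, h2, hp.wMean_const] at h
  linarith

end Coupling

/-! ### Choice of constants and the main estimate. -/

section Core

/-- The constant of the main theorem, in terms of a bound `B` for the fourth moment. -/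
noncomputable def tailConst (B : ℝ) : ℝ := 2 ^ 36 * B ^ 2 + 600000

theorem natLog_two_add_one_le {d : ℕ} (hd : 2 ≤ d) :
    ((Nat.log 2 d + 1 : ℕ) : ℝ) ≤ 3 * Real.log d := by
  have hlog : Real.log 2 * Nat.log 2 d ≤ Real.log d := by
    rw [mul_comm, ← Real.log_pow]
    refine Real.log_le_log (by positivity) ?_
    exact_mod_cast Nat.pow_log_le_self 2 (by lia)
  have h2 : Real.log 2 ≤ Real.log d :=
    Real.log_le_log two_pos (by exact_mod_cast hd)
  have := Real.log_two_gt_d9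
  push_cast
  nlinarith

theorem natCast_le_sq_mul_log {d : ℕ} (hd : 2 ≤ d) : (d : ℝ) ≤ (d : ℝ) ^ 2 * Real.log d := by
  have h2 : Real.log 2 ≤ Real.log d :=
    Real.log_le_log two_pos (by exact_mod_cast hd)
  have := Real.log_two_gt_d9
  have hd' : (2 : ℝ) ≤ d := by exact_mod_cast hd
  have : 1 ≤ d * Real.log d := by nlinarith
  nlinarith

theorem natCast_le_two_pow (d : ℕ) : (d : ℝ) ≤ 2 ^ d := by
  exact_mod_cast Nat.lt_two_pow_self.le

/-- Factors 2^24, B and d^6 are traded for d-th powers; 2^24 · 64 · 2^6 = 2^36 fixes the leading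
constant of `tailConst`. -/
theorem influence_constant_le {B : ℝ} (hB : 1 ≤ B) {d : ℕ} (hd : 2 ≤ d) :
    2 ^ 24 * (B * (64 * B) ^ d) * d ^ 6 ≤ (2 ^ 36 * B ^ 2) ^ d := by
  have h0 : d ≠ 0 := by lia
  calc 2 ^ 24 * (B * (64 * B) ^ d) * (d : ℝ) ^ 6
      ≤ (2 ^ 24) ^ d * (B ^ d * (64 * B) ^ d) * (2 ^ d) ^ 6 := by
        gcongr
        · exact le_self_pow₀ (by norm_num) h0
        · exact le_self_pow₀ hB h0
        · exact natCast_le_two_pow d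
    _ = (2 ^ 36 * B ^ 2) ^ d := by
        rw [← pow_mul (2 : ℝ) d 6, mul_comm d 6, pow_mul (2 : ℝ) 6 d, ← mul_pow, ← mul_pow, ← mul_pow]
        congr 1
        ring

theorem prefactor_le {B : ℝ} (hB : 1 ≤ B) {d : ℕ} (hd : 2 ≤ d) :
    2 ^ 17 * (B * (64 * B) ^ d) * d ^ 5 * 48 ^ d ≤ (2 ^ 36 * B ^ 2) ^ d := by
  have h0 : d ≠ 0 := by lia
  calc 2 ^ 17 * (B * (64 * B) ^ d) * (d : ℝ) ^ 5 * 48 ^ d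
      ≤ (2 ^ 17) ^ d * (B ^ d * (64 * B) ^ d) * (2 ^ d) ^ 5 * 48 ^ d := by
        gcongr
        · exact le_self_pow₀ (by norm_num) h0
        · exact le_self_pow₀ hB h0
        · exact natCast_le_two_pow d
    _ = (2 ^ 17 * (B * (64 * B)) * 2 ^ 5 * 48) ^ d := by
        rw [← pow_mul (2 : ℝ) d 5, mul_comm d 5, pow_mul (2 : ℝ) 5 d, ← mul_pow, ← mul_pow, ← mul_pow, ← mul_pow]
    _ ≤ _ := by
        gcongr ?_ ^ d
        nlinarith [sq_nonneg B]

theorem numerical_estimate {B M t L : ℝ} (hB : 1 ≤ B) {d : ℕ} (hd : 2 ≤ d) (hM : 0 < M)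
    (ht : 0 < t) (hMt : M ≤ t ^ 2) (hL0 : 0 < L) (hLd : L ≤ d) (hL3 : L ≤ 3 * Real.log d) :
    Real.exp (-(tailConst B * t ^ 2 * d ^ 2 * Real.log d / M)) ≤
      Real.exp (-(96 * (8 * d * t) ^ 2 / (M / (8 * L) / 4))) / 8 / (16 * d * 48 ^ d) *
        ((M / (8 * L) / 2) ^ 2 / (4 * (B * (64 * B) ^ d * (d * M) ^ 2))) := by
  have hdr : (0 : ℝ) < d := by exact_mod_cast (by lia : 0 < d)
  set K := B * (64 * B) ^ d with hK
  have hK0 : 0 < K := by positivity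
  have e4 : 96 * (8 * d * t) ^ 2 / (M / (8 * L) / 4) =
      196608 * (t ^ 2 / M * (d ^ 2 * L)) := by
    field_simp; norm_num
  rw [e4]
  set Y := 196608 * (t ^ 2 / M * (d ^ 2 * L)) with hY
  have e1 : Real.exp (-Y) / 8 / (16 * d * 48 ^ d) *
      ((M / (8 * L) / 2) ^ 2 / (4 * (K * (d * M) ^ 2))) =
      Real.exp (-Y) / (2 ^ 17 * K * d ^ 3 * L ^ 2 * 48 ^ d) := by
    generalize Real.exp (-Y) = x
    field_simp
    ring
  have e2 : 2 ^ 17 * K * d ^ 3 * L ^ 2 * 48 ^ d ≤ Real.exp (2 ^ 36 * B ^ 2 * d) :=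
    calc 2 ^ 17 * K * d ^ 3 * L ^ 2 * 48 ^ d ≤ 2 ^ 17 * K * d ^ 3 * d ^ 2 * 48 ^ d := by gcongr
      _ = 2 ^ 17 * K * d ^ 5 * 48 ^ d := by ring
      _ ≤ (2 ^ 36 * B ^ 2) ^ d := prefactor_le hB hd
      _ ≤ Real.exp (2 ^ 36 * B ^ 2) ^ d := by
        gcongr
        linarith [Real.add_one_le_exp (2 ^ 36 * B ^ 2)]
      _ = _ := by rw [← Real.exp_nat_mul, mul_comm]
  rw [e1, le_div_iff₀ (by positivity)]
  refine (mul_le_mul_of_nonneg_left e2 (Real.exp_pos _).le).trans ?_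
  rw [← Real.exp_add, Real.exp_le_exp]
  have hlog := natCast_le_sq_mul_log hd
  set D := (d : ℝ) ^ 2 * Real.log d with hD
  have hD0 : 0 ≤ D := hdr.le.trans hlog
  -- M ≤ t² is what lets the exponential-in-d prefactor be absorbed into the main exponent. The
  -- other part costs 3 · 196608 ≤ 600000.
  have e3 : (d : ℝ) ≤ t ^ 2 / M * D :=
    hlog.trans (le_mul_of_one_le_left hD0 ((one_le_div hM).2 hMt))
  have e5 : t ^ 2 / M * (d ^ 2 * L) ≤ 3 * (t ^ 2 / M * D) := by
    have : (d : ℝ) ^ 2 * L ≤ 3 * D := by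
      rw [hD]; nlinarith [mul_le_mul_of_nonneg_left hL3 (sq_nonneg (d : ℝ))]
    have h3 : 0 ≤ t ^ 2 / M := by positivity
    nlinarith
  have e6 : tailConst B * t ^ 2 * d ^ 2 * Real.log d / M =
      2 ^ 36 * B ^ 2 * (t ^ 2 / M * D) + 600000 * (t ^ 2 / M * D) := by
    rw [tailConst, hD]; ring
  have e7 : 2 ^ 36 * B ^ 2 * (d : ℝ) ≤ 2 ^ 36 * B ^ 2 * (t ^ 2 / M * D) := by gcongr
  have e8 : 0 ≤ t ^ 2 / M * D := hdr.le.trans e3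
  rw [hY, e6]
  linarith


variable {ι V : Type*} [Fintype ι] [DecidableEq ι] [Fintype V] [DecidableEq V]

theorem exp_le_wProb_abs_multiAffine {p X : V → ℝ} (hp : IsProbWeight p) (h1 : wMean p X = 0)
    (h2 : wMean p (fun x => X x ^ 2) = 1) {d : ℕ} (hd : 2 ≤ d) (c : Finset ι → ℝ)
    (hc : ∀ S, d < #S → c S = 0) (J : Finset ι) {t : ℝ} (ht : 0 < t)
    (hM : 0 < massOutside c J) (hMt : massOutside c J ≤ t ^ 2)
    (hI : ∀ i ∉ J, infl c i ≤
      massOutside c J ^ 2 / t ^ 2 / tailConst (wMean p (fun x => X x ^ 4)) ^ d) :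
    Real.exp (-(tailConst (wMean p (fun x => X x ^ 4)) * t ^ 2 * d ^ 2 * Real.log d /
        massOutside c J)) ≤
      wProb (prodWeight fun _ : ι => p) {x | t ≤ |multiAffine c univ (fun i => X (x i))|} := by
  set B := wMean p (fun x => X x ^ 4) with hBdef
  have hB : 1 ≤ B := one_le_fourth_moment hp h2
  obtain ⟨k, hk, hkM⟩ := exists_dyadic_level c hc J
  set M := massOutside c J with hMdef
  have hL3 := natLog_two_add_one_le hd
  have hLd : ((Nat.log 2 d + 1 : ℕ) : ℝ) ≤ d := by
    exact_mod_cast Nat.succ_le_of_lt (Nat.log_lt_self 2 (by lia))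
  have hL0 : (0 : ℝ) < (Nat.log 2 d + 1 : ℕ) := by positivity
  set L : ℝ := ((Nat.log 2 d + 1 : ℕ) : ℝ) with hLdef
  have hd0 : 0 < d := by lia
  have hdr : (0 : ℝ) < d := by exact_mod_cast hd0
  set K := B * (64 * B) ^ d with hK
  have hK0 : 0 < K := by positivity
  have hC1 : (2 ^ 36 * B ^ 2) ^ d ≤ tailConst B ^ d := by
    gcongr
    rw [tailConst]
    linarith
  have hC0 : 0 < tailConst B ^ d := lt_of_lt_of_le (by positivity) hC1
  -- the random restriction
  set ε : ι → ℝ := fun i => if i ∈ J then 0 else 1 / k with hε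
  have hk1 : (1 : ℝ) ≤ k := by exact_mod_cast hk
  have hε0 : ∀ i, 0 ≤ ε i := fun i => by simp only [hε]; split_ifs <;> positivity
  have hε1 : ∀ i, ε i ≤ 1 := fun i => by
    simp only [hε]
    split_ifs
    · exact zero_le_one
    · exact (div_le_one (by linarith)).2 hk1
  have hw := fun i => isProbWeight_pairWeight hp (hε0 i) (hε1 i)
  have hu := fun i => wMean_pairMid hp h1 (ε i)
  have hu2 := fun i => wMean_pairMid_sq hp h1 h2 (ε i)
  have hv2 := fun i => wMean_pairDiff_sq hp h1 h2 (ε i)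
  have hu4 := fun i => wMean_pairMid_pow_four_le (X := X) hp (hε0 i)
  have hv4 := fun i => wMean_pairDiff_pow_four_le (X := X) hp (hε0 i) (hε1 i)
  set w := fun i => pairWeight p (ε i) with hwdef
  set q := M / (8 * L) with hq
  have hq0 : 0 < q := by positivity
  have hQ : q ≤ wMean (prodWeight w) (fun ω => ∑ i ∈ Jᶜ,
      (pairDiff X (ω i) * partialDeriv c i (fun l => pairMid X (ω l))) ^ 2) := by
    refine le_trans ?_ (le_wMean_sum_sq hw (u := fun _ => pairMid X) (v := fun _ => pairDiff X)
      hu c J hk (fun i => ?_) (fun i hi => ?_))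
    · rw [hq, mul_comm, ← div_div]
      gcongr
    · rw [hu2]
      simp only [hε]
      split_ifs <;> ring
    · rw [hv2]
      simp only [hε, if_neg hi]
      ring
  -- θ is chosen so that |a_i| ≤ √θ gives 4T|a_i| ≤ q/4 for T = 8dt, as the Rademacher bound
  -- requires.
  have key := wProb_truncated_sum_ge hw (u := fun _ => pairMid X) (v := fun _ => pairDiff X) hB hu
    (fun i => by rw [hu2]; linarith [hε0 i]) (fun i => by rw [hu2]; linarith [hε1 i]) hu4 hv4
    c hd0 hc J (η := M ^ 2 / t ^ 2 / tailConst B ^ d) (θ := (q / (128 * d * t)) ^ 2) (q := q) hM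
    le_rfl hI (by positivity) (by positivity) hq0 (by
      have e1 := (influence_constant_le hB hd).trans hC1
      rw [← hK] at e1
      have e2 : 2 ^ 24 * K * d ^ 3 * L ^ 3 ≤ tailConst B ^ d := by
        refine le_trans ?_ e1
        rw [show 2 ^ 24 * K * (d : ℝ) ^ 6 = 2 ^ 24 * K * d ^ 3 * d ^ 3 by ring]
        gcongr
      rw [← hK]
      have e3 : (q / (128 * d * t)) ^ 2 * (q / 2) = M ^ 3 / (2 ^ 24 * L ^ 3 * d ^ 2 * t ^ 2) := by
        rw [hq]; field_simp; norm_num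
      have e4 : K * (M ^ 2 / t ^ 2 / tailConst B ^ d) * (d * M) =
          K * d * M ^ 3 / (t ^ 2 * tailConst B ^ d) := by field_simp
      rw [e3, e4, div_le_div_iff₀ (by positivity) (by positivity)]
      calc K * d * M ^ 3 * (2 ^ 24 * L ^ 3 * d ^ 2 * t ^ 2)
          = (2 ^ 24 * K * d ^ 3 * L ^ 3) * (M ^ 3 * t ^ 2) := by ring
        _ ≤ tailConst B ^ d * (M ^ 3 * t ^ 2) := by gcongr
        _ = _ := by ring) hQ
  -- the conditional estimate
  set T : ℝ := 8 * d * t with hT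
  set β := Real.exp (-(96 * T ^ 2 / (q / 4))) / 8 / (16 * d * 48 ^ d) with hβ
  have hcoin := isProbWeight_prodWeight (fun _ : ι => isProbWeight_coin)
  have hcond := (isProbWeight_prodWeight hw).mul_wProb_le_wMean (a := β)
    (s := {ω | q / 4 ≤ ∑ i ∈ Jᶜ with
      (pairDiff X (ω i) * partialDeriv c i (fun l => pairMid X (ω l))) ^ 2 ≤
        (q / (128 * d * t)) ^ 2,
      (pairDiff X (ω i) * partialDeriv c i (fun l => pairMid X (ω l))) ^ 2})
    (F := fun r => wProb (prodWeight fun _ : ι => coin)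
      {τ | t ≤ |multiAffine c univ (fun i => X (pairSelect (r i) (τ i)))|})
    (fun r => hcoin.wProb_nonneg _) (fun r hr => by
      simp only [apply_pairSelect]
      refine le_trans ?_ (wProb_signs_ge c hd0 hc (fun i => pairMid X (r i))
        (fun i => pairDiff X (r i)) ht)
      rw [hβ]
      gcongr
      refine wProb_rademacher_abs_ge _ _ (by positivity) (by positivity) hr ?_ fun i hi => ?_
      · rw [hT, hq]
        have hd2 : (2 : ℝ) ≤ d := by exact_mod_cast hd
        have hL1 : (1 : ℝ) ≤ L := by
          rw [hLdef]; exact_mod_cast Nat.succ_le_succ (Nat.zero_le _)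
        have e1 : M / (8 * L) ≤ M := div_le_self hM.le (by linarith)
        have e2 : t ^ 2 ≤ (8 * d * t) ^ 2 := by
          rw [mul_pow]
          exact le_mul_of_one_le_left (by positivity) (by nlinarith)
        linarith
      · have hi2 := abs_le_of_sq_le_sq (mem_filter.1 hi).2 (by positivity)
        calc 4 * T * |pairDiff X (r i) * partialDeriv c i fun i => pairMid X (r i)|
            ≤ 4 * T * (q / (128 * d * t)) := by gcongr
          _ = q / 4 := by rw [hT]; field_simp; norm_num)
  have hcouple := wMean_pairSelect (ι := ι) hp ε
    (Set.indicator {x | t ≤ |multiAffine c univ (fun i => X (x i))|} fun _ => 1)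
  have hfinal : β * ((q / 2) ^ 2 / (4 * (K * (d * M) ^ 2))) ≤
      wProb (prodWeight fun _ : ι => p) {x | t ≤ |multiAffine c univ (fun i => X (x i))|} := by
    have hβ0 : 0 ≤ β := by positivity
    calc _ ≤ β * _ := mul_le_mul_of_nonneg_left key hβ0
      _ ≤ _ := hcond
      _ = _ := hcouple
  refine le_trans ?_ hfinal
  exact numerical_estimate hB hd hM ht hMt hL0 hLd hL3

end Core

/-! ### From multilinear polynomials to coefficient functions. -/

section Polynomial

variable {n : ℕ}

theorem sum_single_apply (S : Finset (Fin n)) (i : Fin n) :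
    (∑ j ∈ S, Finsupp.single j 1 : Fin n →₀ ℕ) i = if i ∈ S then 1 else 0 := by
  simp [Finsupp.finsetSum_apply, Finsupp.single_apply]

theorem eval_eq_multiAffine {f : MvPolynomial (Fin n) ℝ} (hf : IsMultilinearPoly f)
    (x : Fin n → ℝ) : MvPolynomial.eval x f = multiAffine (multilinearCoeff f) univ x := by
  have hinj : Function.Injective
      (fun S : Finset (Fin n) => (∑ j ∈ S, Finsupp.single j 1 : Fin n →₀ ℕ)) := fun S S' h => by
    ext i
    have := DFunLike.congr_fun h i
    simp only [sum_single_apply] at this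
    by_cases h1 : i ∈ S <;> by_cases h2 : i ∈ S' <;> simp_all
  have hsub : f.support ⊆
      univ.image (fun S : Finset (Fin n) => (∑ j ∈ S, Finsupp.single j 1 : Fin n →₀ ℕ)) :=
    fun m hm => by
      refine mem_image.2 ⟨m.support, mem_univ _, Finsupp.ext fun i => ?_⟩
      have h1 : m i ≤ 1 := (MvPolynomial.monomial_le_degreeOf i hm).trans (hf i)
      rw [sum_single_apply]
      split_ifs with h
      · have := Finsupp.mem_support_iff.1 h
        lia
      · exact (Finsupp.notMem_support_iff.1 h).symm
  rw [MvPolynomial.eval_eq', sum_subset hsub fun m _ hm => by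
    rw [MvPolynomial.notMem_support_iff.1 hm, zero_mul], sum_image fun S _ S' _ h => hinj h,
    multiAffine, powerset_univ]
  refine sum_congr rfl fun S _ => ?_
  rw [multilinearCoeff]
  congr 1
  simp only [sum_single_apply, pow_ite, pow_one, pow_zero]
  rw [prod_ite_mem, univ_inter]

theorem multilinearCoeff_eq_zero {f : MvPolynomial (Fin n) ℝ} {d : ℕ} (hf : f.totalDegree ≤ d)
    (S : Finset (Fin n)) (hS : d < #S) : multilinearCoeff f S = 0 := by
  refine MvPolynomial.coeff_eq_zero_of_totalDegree_lt ?_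
  have h1 : (∑ j ∈ S, Finsupp.single j 1 : Fin n →₀ ℕ).support = S := by
    ext i
    rw [Finsupp.mem_support_iff, sum_single_apply]
    simp
  rw [h1, sum_congr rfl fun i hi => by rw [sum_single_apply, if_pos hi], sum_const, smul_eq_mul,
    mul_one]
  lia

end Polynomial

/-! ### From a finitely supported measure to weights on its support. -/

section Law

open MeasureTheory

theorem integral_eq_wMean {μ : Measure ℝ} [IsProbabilityMeasure μ] {V : Finset ℝ}
    (hV : μ (V : Set ℝ)ᶜ = 0) (g : ℝ → ℝ) :
    ∫ x, g x ∂μ = wMean (fun x : V => μ.real {(x : ℝ)}) (fun x => g x) := by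
  have hr : μ.restrict (V : Set ℝ) = μ := Measure.restrict_eq_self_of_ae_mem hV
  rw [← hr, setIntegral_finset V (IntegrableOn.finset), hr, wMean,
    ← sum_coe_sort V (fun x => μ.real {x} • g x)]
  simp

theorem isProbWeight_singleton {μ : Measure ℝ} [IsProbabilityMeasure μ] {V : Finset ℝ}
    (hV : μ (V : Set ℝ)ᶜ = 0) : IsProbWeight (fun x : V => μ.real {(x : ℝ)}) where
  nonneg _ := measureReal_nonneg
  sum_eq_one := by
    have := integral_eq_wMean hV (fun _ => 1)
    simpa [wMean] using this.symm

theorem wProb_le_measureReal_pi {ι : Type*} [Fintype ι] [DecidableEq ι] {μ : Measure ℝ}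
    [IsProbabilityMeasure μ] (V : Finset ℝ) (s : Set (ι → ℝ)) :
    wProb (prodWeight fun (_ : ι) (x : V) => μ.real {(x : ℝ)}) {x | (fun i => (x i : ℝ)) ∈ s} ≤
      (Measure.pi fun _ : ι => μ).real s := by
  classical
  have hinj : Function.Injective (fun (x : ι → V) i => (x i : ℝ)) := fun x y h =>
    funext fun i => Subtype.ext (congrFun h i)
  have h1 : ∀ x : ι → V, prodWeight (fun (_ : ι) (x : V) => μ.real {(x : ℝ)}) x =
      (Measure.pi fun _ : ι => μ).real {fun i => (x i : ℝ)} := fun x => by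
    rw [prodWeight, measureReal_def, Measure.pi_singleton, ENNReal.toReal_prod]
    rfl
  have h2 : wProb (prodWeight fun (_ : ι) (x : V) => μ.real {(x : ℝ)})
      {x | (fun i => (x i : ℝ)) ∈ s} =
      (Measure.pi fun _ : ι => μ).real
        ((univ.filter fun x : ι → V => (fun i => (x i : ℝ)) ∈ s).image
          fun x i => (x i : ℝ) : Finset (ι → ℝ)) := by
    rw [← sum_measureReal_singleton, sum_image fun x _ y _ h => hinj h, sum_filter]
    refine sum_congr rfl fun x _ => ?_
    simp [Set.indicator_apply, h1]
  rw [h2]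
  refine measureReal_mono ?_
  intro y hy
  obtain ⟨x, hx, rfl⟩ := mem_image.1 (mem_coe.1 hy)
  exact (mem_filter.1 hx).2

end Law

theorem theorem4p1 (μ : MeasureTheory.Measure ℝ) (hμ : IsFinitelySupportedStandardized μ) :
    ∃ C : ℝ, 0 < C ∧
      ∀ (n d : ℕ), 2 ≤ d →
      ∀ f : MvPolynomial (Fin n) ℝ, IsMultilinearPoly f → f.totalDegree ≤ d →
      ∀ (J : Finset (Fin n)) (δ t : ℝ), 0 < δ →
        δ ≤ fourierMassOutside f J →
        Real.sqrt δ ≤ t →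
        (∀ i : Fin n, i ∉ J → influence f i ≤ δ ^ 2 * t ^ (-2 : ℤ) * C ^ (-(d : ℤ))) →
        Real.exp (-(C * t ^ 2 * (d : ℝ) ^ 2 * Real.log d / δ)) ≤
          (MeasureTheory.Measure.pi (fun _ : Fin n => μ)).real
            {x : Fin n → ℝ | t ≤ |MvPolynomial.eval x f|} := by
  obtain ⟨hprob, ⟨V, hV⟩, hmean, hvar⟩ := hμ
  set p : V → ℝ := fun x => μ.real {(x : ℝ)} with hpdef
  have hp : IsProbWeight p := isProbWeight_singleton hV
  set X : V → ℝ := fun x => x with hX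
  have h1 : wMean p X = 0 := (integral_eq_wMean hV fun x => x).symm.trans hmean
  have h2 : wMean p (fun x => X x ^ 2) = 1 := by
    rw [ProbabilityTheory.variance_eq_integral aemeasurable_id] at hvar
    simp only [id, hmean, sub_zero] at hvar
    exact (integral_eq_wMean hV fun x => x ^ 2).symm.trans hvar
  set C := tailConst (wMean p fun x => X x ^ 4) with hC
  have hC0 : 0 < C := by rw [hC, tailConst]; positivity
  refine ⟨C, hC0, fun n d hd f hf hfd J δ t hδ hM ht hI => ?_⟩
  set M := massOutside (multilinearCoeff f) J with hMdef
  change δ ≤ M at hM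
  have hM0 : 0 < M := hδ.trans_le hM
  have ht0 : 0 < t := (Real.sqrt_pos.2 hδ).trans_le ht
  have hδt : δ ≤ t ^ 2 := (Real.sqrt_le_iff.1 ht).2
  -- The core estimate uses the true mass M and needs M ≤ s². Raising the threshold to s only
  -- shrinks the event, and s²/M ≤ t²/δ keeps both the exponent and the influence bound within the
  -- hypotheses.
  set s := max t (√M) with hs
  have hs0 : 0 < s := ht0.trans_le (le_max_left _ _)
  have hratio : s ^ 2 / M ≤ t ^ 2 / δ := by
    rcases le_total t (√M) with h | h
    · rw [hs, max_eq_right h, Real.sq_sqrt hM0.le, div_self hM0.ne', one_le_div hδ]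
      exact hδt
    · rw [hs, max_eq_left h]
      gcongr
  have hMs : M ≤ s ^ 2 := by
    rw [← Real.sq_sqrt hM0.le]
    exact pow_le_pow_left₀ (Real.sqrt_nonneg _) (le_max_right _ _) 2
  have hinfl : δ ^ 2 / t ^ 2 ≤ M ^ 2 / s ^ 2 := by
    rw [div_le_div_iff₀ hM0 hδ] at hratio
    rw [div_le_div_iff₀ (by positivity) (by positivity)]
    nlinarith [mul_le_mul_of_nonneg_left hratio hδ.le,
      mul_le_mul_of_nonneg_right hM (by positivity : 0 ≤ t ^ 2 * M)]
  have key := exp_le_wProb_abs_multiAffine hp h1 h2 hd (multilinearCoeff f)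
    (multilinearCoeff_eq_zero hfd) J hs0 hM0 hMs fun i hi => by
      refine (hI i hi).trans ?_
      rw [zpow_neg, zpow_neg, zpow_natCast, ← div_eq_mul_inv, ← div_eq_mul_inv]
      exact div_le_div_of_nonneg_right (by exact_mod_cast hinfl) (by positivity)
  have hd1 : 0 ≤ Real.log d := Real.log_natCast_nonneg d
  calc Real.exp (-(C * t ^ 2 * (d : ℝ) ^ 2 * Real.log d / δ))
      ≤ Real.exp (-(C * s ^ 2 * (d : ℝ) ^ 2 * Real.log d / M)) := by
        rw [Real.exp_le_exp, neg_le_neg_iff]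
        calc C * s ^ 2 * (d : ℝ) ^ 2 * Real.log d / M
            = C * (d : ℝ) ^ 2 * Real.log d * (s ^ 2 / M) := by ring
          _ ≤ C * (d : ℝ) ^ 2 * Real.log d * (t ^ 2 / δ) := by gcongr
          _ = _ := by ring
    _ ≤ _ := key
    _ ≤ wProb (prodWeight fun (_ : Fin n) (x : V) => μ.real {(x : ℝ)})
          {x | (fun i => (x i : ℝ)) ∈ {x : Fin n → ℝ | t ≤ |MvPolynomial.eval x f|}} := by
        refine (isProbWeight_prodWeight fun _ => hp).wProb_mono fun x hx => ?_
        have hx' : s ≤ |multiAffine (multilinearCoeff f) univ (fun i => (x i : ℝ))| := hx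
        change t ≤ |MvPolynomial.eval (fun i => (x i : ℝ)) f|
        rw [eval_eq_multiAffine hf]
        exact (le_max_left _ _).trans hx'
    _ ≤ _ := wProb_le_measureReal_pi V _
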